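/- Let $\mathbb N=\{1,2,\dots\}$. An infinite binary information system is a pair $U=(A,F)$, where $A$ is an infinite set and $F$ is an infinite set of functions (attributes) $A\to\{0,1\}$. A problem over $U$ is a tuple $z=(\nu,f_1,\dots,f_n)$ with $n\in\mathbb N$, $\nu:\{0,1\}^n\to\mathbb N$ and $f_1,\dots,f_n\in F$; put $z(a)=\nu(f_1(a),\dots,f_n(a))$ for $a \in A$ and $\dim z=n$. A decision tree over $U$ is a finite directed rooted tree in which the root and the (at least one) edges leaving it are unlabelled, each terminal node is labelled with a number from $\mathbb N$, each other non-root node (working node) is labelled with an attribute from $F$, and each edge leaving a working node is labelled with $0$ or $1$. It is deterministic if exactly one edge leaves the root and edges leaving the same working node have different labels. A complete path $\xi$ is a directed path from the root to a terminal node, and $A(\xi)$ is the set of $a\in A$ such that $f(a)=\delta$ for every working node of $\xi$, where $f$ is its label and $\delta$ is the label of the edge of $\xi$ leaving it. A tree solves $z$ nondeterministically if every $a\in A$ lies in $A(\xi)$ for some complete path $\xi$ and, whenever $a\in A(\xi)$, the terminal node of $\xi$ is labelled $z(a)$; it solves $z$ deterministically if in addition it is deterministic. The depth of a tree is the maximum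 number of working nodes in a complete path. Let $h^d_U(z)$ and $L^d_U(z)$ (respectively $h^a_U(z)$ and $L^a_U(z)$) be the minimum depth and the minimum number of nodes (including the root) of a decision tree over $U$ solving $z$ deterministically (respectively nondeterministically), and for $n\in\mathbb N$ let $h^d_U(n),h^a_U(n),L^d_U(n),L^a_U(n)$ be the maxima of these values over all problems $z$ over $U$ with $\dim z\le n$. For $m\in\mathbb N$, an $(m,U)$-set is a nonempty solution set in $A$ of a system $\{f_1(x)=\delta_1,\dots,f_m(x)=\delta_m\}$ with $f_i\in F$ (not necessarily different) and $\delta_i\in\{0,1\}$. $U$ satisfies the condition of coverage if for some $m\in\mathbb N$ every $(m+1,U)$-set is a union of finitely many $(m,U)$-sets, and the condition of restricted coverage if for some $m,t\in\mathbb N$ every $(m+1,U)$-set is a union of at most $t$ $(m,U)$-sets. A finite set $S\subseteq F$ is independent if for every choice of $\delta_f\in\{0,1\}$, $f\in S$, the system $\{f(x)=\delta_f : f\in S\}$ has a solution in $A$; $I(U)\in\{0,1,\dots\}\cup\{\infty\}$ is the supremum of the cardinalities of independent subsets of $F$. Types of behavior. The function $h^d_U$ has type LOG if for every $\varepsilon\in(0,1)$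 there is $c>0$ with $\log_2(n+1)\le h^d_U(n)\le c(\log_2 n)^{1+\varepsilon}+1$ for all $n\in\mathbb N$, and type LIN if $h^d_U(n)=n$ for all $n\in\mathbb N$. The function $h^a_U$ has type CON if it is bounded from above by a constant, and type LIN if $h^a_U(n)=n$ for all $n\in\mathbb N$. A function $L\in\{L^d_U,L^a_U\}$ has type POL if $I(U)<\infty$ and $2(n+1)\le L(n)\le 2(4n)^{I(U)}$ for all $n\in\mathbb N$, and type EXP if $L(n)=2^{n+1}$ for all $n\in\mathbb N$. The type of $U$ is the tuple of types of $(h^d_U,h^a_U,L^d_U,L^a_U)$. **Theorem 1.** (a) Every infinite binary information system $U$ has exactly one type, and this type is one of the five rows 1. (LOG, CON, POL, POL), 2. (LIN, CON, POL, POL), 3. (LIN, LIN, POL, POL), 4. (LIN, CON, EXP, EXP), 5. (LIN, LIN, EXP, EXP). Here $h^d_U$ has type LOG if and only if $I(U)<\infty$ and $U$ satisfies the condition of restricted coverage, $h^a_U$ has type CON if and only if $U$ satisfies the condition of coverage, and $L^d_U$ (equivalently $L^a_U$) has type POL if and only if $I(U)<\infty$. (b) Each row is the type of some infinite binary information system.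 For $i,j\in\mathbb N$ let $p_i(j)=1$ iff $j=i$, and $l_i(j)=1$ iff $j>i$ (and $0$ otherwise). Then rows $1,\dots,5$ are, respectively, the types of $U_1=(\mathbb N,\{l_i:i\in\mathbb N\})$; $U_2=(\mathbb N,\{p_i:i\in\mathbb N\}\cup\{l_{2^i}:i\in\mathbb N\})$; $U_3=(\mathbb N,\{p_i:i\in\mathbb N\})$; $U_4=(\mathbb N,\text{all functions }\mathbb N\to\{0,1\})$; and $U_5=(\{0,1\}^{\mathbb N},\{f_i:i\in\mathbb N\})$ with $f_i(a_1,a_2,\dots)=a_i$. -/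

import Mathlib

universe u

/-- An infinite binary information system `U = (A, F)`: an infinite set `A` of objects (the universe)
and an infinite set `F` of attributes, i.e. functions from `A` to `{0,1}`
(`false` is `0`, `true` is `1`). -/
structure InfoSystem where
  /-- the universe -/
  A : Type u
  /-- the set of attributes -/
  F : Set (A → Bool)
  infinite_A : Infinite A
  infinite_F : F.Infinite

/-- A subtree of a decision tree hanging below an edge, with working nodes labelled by elements of
`α`. It is a terminal node labelled with a positive integer, or a working node labelled
with an attribute, with `k + 1 ≥ 1` leaving edges; the `i`-th edge is labelled with the bit
`label i` and enters the root of the subtree `child i`. Several edges may have the same label. -/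
inductive TreeNode (α : Type u) : Type u
  | terminal (d : ℕ+) : TreeNode α
  | working (f : α) (k : ℕ) (label : Fin (k + 1) → Bool)
      (child : Fin (k + 1) → TreeNode α) : TreeNode α

namespace TreeNode

variable {α : Type u}

/-- The maximum number of working nodes on a path to a terminal node. -/
def depth : TreeNode α → ℕ
  | terminal _ => 0
  | working _ _ _ child => 1 + Finset.univ.sup fun i => (child i).depth

/-- The number of nodes. -/
def size : TreeNode α → ℕ
  | terminal _ => 1
  | working _ _ _ child => 1 + ∑ i, (child i).size

/-- Edges leaving one and the same working node have pairwise different labels. -/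
def Deterministic : TreeNode α → Prop
  | terminal _ => True
  | working _ _ label child => Function.Injective label ∧ ∀ i, (child i).Deterministic

/-- `t.IsPath ξ d`: there is a directed path in `t` from its root to a terminal node labelled `d`
along which the working nodes and the edges leaving them carry the successive labels
listed in `ξ`. -/
inductive IsPath : TreeNode α → List (α × Bool) → ℕ+ → Prop
  | terminal (d : ℕ+) : IsPath (terminal d) [] d
  | working (f : α) (k : ℕ) (label : Fin (k + 1) → Bool) (child : Fin (k + 1) → TreeNode α)
      (i : Fin (k + 1)) (ξ : List (α × Bool)) (d : ℕ+) (h : IsPath (child i) ξ d) :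
      IsPath (working f k label child) ((f, label i) :: ξ) d

end TreeNode

/-- A decision tree: an unlabelled root with `k + 1 ≥ 1` leaving unlabelled edges. -/
structure DecisionTree (α : Type u) where
  k : ℕ
  child : Fin (k + 1) → TreeNode α

namespace DecisionTree

variable {α : Type u}

/-- The maximum number of working nodes in a complete path. -/
def depth (Γ : DecisionTree α) : ℕ := Finset.univ.sup fun i => (Γ.child i).depth

/-- The number of nodes, the root included. -/
def size (Γ : DecisionTree α) : ℕ := 1 + ∑ i, (Γ.child i).size

/-- Exactly one edge leaves the root, and edges leaving a working node have different labels. -/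
def Deterministic (Γ : DecisionTree α) : Prop := Γ.k = 0 ∧ ∀ i, (Γ.child i).Deterministic

/-- Complete paths: from the root to a terminal node labelled `d`. -/
def IsPath (Γ : DecisionTree α) (ξ : List (α × Bool)) (d : ℕ+) : Prop :=
  ∃ i, (Γ.child i).IsPath ξ d

end DecisionTree

namespace InfoSystem

/-- A problem `z = (ν, f₁, …, fₙ)` over `U`, `n ≥ 1`. -/
structure Problem (U : InfoSystem.{u}) where
  dim : ℕ
  dim_pos : 1 ≤ dim
  ν : (Fin dim → Bool) → ℕ+
  f : Fin dim → U.F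

/-- `z(a) = ν (f₁ a, …, fₙ a)`. -/
def Problem.value {U : InfoSystem.{u}} (z : U.Problem) (a : U.A) : ℕ+ :=
  z.ν fun i => (z.f i).1 a

variable (U : InfoSystem.{u})

/-- Decision trees over `U`: working nodes are labelled with attributes of `U`. -/
abbrev Tree : Type u := DecisionTree U.F

/-- The set `A(ξ)` of solutions of the equations read along a complete path. -/
def solutions (ξ : List (U.F × Bool)) : Set U.A := {a | ∀ e ∈ ξ, e.1.1 a = e.2}

variable {U}

/-- `Γ` solves `z` nondeterministically. -/
def SolvesNondet (Γ : U.Tree) (z : U.Problem) : Prop :=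
  (∀ a, ∃ ξ d, Γ.IsPath ξ d ∧ a ∈ U.solutions ξ) ∧
    ∀ a ξ d, Γ.IsPath ξ d → a ∈ U.solutions ξ → d = z.value a

/-- `Γ` solves `z` deterministically. -/
def SolvesDet (Γ : U.Tree) (z : U.Problem) : Prop := Γ.Deterministic ∧ SolvesNondet Γ z

/-- Minimum depth of a decision tree over `U` solving `z` deterministically. -/
noncomputable def Problem.hd (z : U.Problem) : ℕ∞ :=
  ⨅ (Γ : U.Tree) (_ : SolvesDet Γ z), (Γ.depth : ℕ∞)

/-- Minimum depth of a decision tree over `U` solving `z` nondeterministically. -/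
noncomputable def Problem.ha (z : U.Problem) : ℕ∞ :=
  ⨅ (Γ : U.Tree) (_ : SolvesNondet Γ z), (Γ.depth : ℕ∞)

/-- Minimum number of nodes of a decision tree over `U` solving `z` deterministically. -/
noncomputable def Problem.Ld (z : U.Problem) : ℕ∞ :=
  ⨅ (Γ : U.Tree) (_ : SolvesDet Γ z), (Γ.size : ℕ∞)

/-- Minimum number of nodes of a decision tree over `U` solving `z` nondeterministically. -/
noncomputable def Problem.La (z : U.Problem) : ℕ∞ :=
  ⨅ (Γ : U.Tree) (_ : SolvesNondet Γ z), (Γ.size : ℕ∞)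

variable (U)

/-- `h_U^d(n)`: worst case of `hd z` over problems of dimension at most `n`. The values are taken
in `ℕ∞`, where a supremum of a nonempty set that is finite is a maximum. -/
noncomputable def hd (n : ℕ) : ℕ∞ := ⨆ (z : U.Problem) (_ : z.dim ≤ n), z.hd

/-- `h_U^a(n)` -/
noncomputable def ha (n : ℕ) : ℕ∞ := ⨆ (z : U.Problem) (_ : z.dim ≤ n), z.ha

/-- `L_U^d(n)` -/
noncomputable def Ld (n : ℕ) : ℕ∞ := ⨆ (z : U.Problem) (_ : z.dim ≤ n), z.Ld

/-- `L_U^a(n)` -/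
noncomputable def La (n : ℕ) : ℕ∞ := ⨆ (z : U.Problem) (_ : z.dim ≤ n), z.La

/-- `B` is an `(m,U)`-set: a nonempty solution set of a system of `m` equations
`f₁(x) = δ₁, …, fₘ(x) = δₘ` with (not necessarily different) attributes of `U`. -/
def IsMSet (m : ℕ) (B : Set U.A) : Prop :=
  B.Nonempty ∧ ∃ (f : Fin m → U.F) (δ : Fin m → Bool), B = {a | ∀ i, (f i).1 a = δ i}

/-- The condition of coverage. -/
def Coverage : Prop :=
  ∃ m : ℕ, 1 ≤ m ∧ ∀ B, U.IsMSet (m + 1) B →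
    ∃ C : Set (Set U.A), C.Finite ∧ (∀ D ∈ C, U.IsMSet m D) ∧ B = ⋃₀ C

/-- The condition of restricted coverage. -/
def RestrictedCoverage : Prop :=
  ∃ m t : ℕ, 1 ≤ m ∧ 1 ≤ t ∧ ∀ B, U.IsMSet (m + 1) B →
    ∃ C : Set (Set U.A), C.encard ≤ t ∧ (∀ D ∈ C, U.IsMSet m D) ∧ B = ⋃₀ C

/-- A finite set `S` of attributes is independent if every system of equations
`f(x) = δ_f`, `f ∈ S`, has a solution. -/
def Independent (S : Finset (U.A → Bool)) : Prop :=
  ∀ δ : (U.A → Bool) → Bool, ∃ a, ∀ f ∈ S, f a = δ f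

/-- The independence dimension `I(U)`. -/
noncomputable def iDim : ℕ∞ :=
  ⨆ (S : Finset (U.A → Bool)) (_ : (S : Set (U.A → Bool)) ⊆ U.F ∧ U.Independent S), (S.card : ℕ∞)

end InfoSystem

/-- Types of behavior of `h_U^d`. -/
inductive DetDepthType
  | LOG
  | LIN

/-- Types of behavior of `h_U^a`. -/
inductive NondetDepthType
  | CON
  | LIN

/-- Types of behavior of `L_U^d` and `L_U^a`. -/
inductive SizeType
  | POL
  | EXP

/-- A tuple of types of behavior of `h_U^d`, `h_U^a`, `L_U^d`, `L_U^a` (16 possibilities). -/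
structure SystemType where
  hd : DetDepthType
  ha : NondetDepthType
  Ld : SizeType
  La : SizeType

/-- The deterministic depth function `h` has the given type of behavior. -/
def DetDepthType.Describes (h : ℕ → ℕ∞) : DetDepthType → Prop
  | LOG => ∀ ε : ℝ, 0 < ε → ε < 1 → ∃ c : ℝ, 0 < c ∧ ∀ n : ℕ, 1 ≤ n → ∃ k : ℕ, h n = k ∧
      Real.logb 2 (n + 1) ≤ k ∧ (k : ℝ) ≤ c * Real.logb 2 n ^ (1 + ε) + 1
  | LIN => ∀ n : ℕ, 1 ≤ n → h n = n

/-- The nondeterministic depth function `h` has the given type of behavior. -/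
def NondetDepthType.Describes (h : ℕ → ℕ∞) : NondetDepthType → Prop
  | CON => ∃ c : ℕ, 0 < c ∧ ∀ n : ℕ, 1 ≤ n → h n ≤ c
  | LIN => ∀ n : ℕ, 1 ≤ n → h n = n

/-- The size function `L` has the given type of behavior; `I` is the independence dimension. -/
def SizeType.Describes (I : ℕ∞) (L : ℕ → ℕ∞) : SizeType → Prop
  | POL => ∃ d : ℕ, I = d ∧ ∀ n : ℕ, 1 ≤ n →
      ((2 * (n + 1) : ℕ) : ℕ∞) ≤ L n ∧ L n ≤ ((2 * (4 * n) ^ d : ℕ) : ℕ∞)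
  | EXP => ∀ n : ℕ, 1 ≤ n → L n = ((2 ^ (n + 1) : ℕ) : ℕ∞)

/-- The four functions of `U` have the types of behavior listed in `τ`. -/
def InfoSystem.HasType (U : InfoSystem.{u}) (τ : SystemType) : Prop :=
  τ.hd.Describes U.hd ∧ τ.ha.Describes U.ha ∧
    τ.Ld.Describes U.iDim U.Ld ∧ τ.La.Describes U.iDim U.La

/-- The five rows of the table of types. -/
def typeTable : Fin 5 → SystemType :=
  ![⟨.LOG, .CON, .POL, .POL⟩,
    ⟨.LIN, .CON, .POL, .POL⟩,
    ⟨.LIN, .LIN, .POL, .POL⟩,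
    ⟨.LIN, .CON, .EXP, .EXP⟩,
    ⟨.LIN, .LIN, .EXP, .EXP⟩]

/-- `pᵢ(j) = 1` iff `j = i`. -/
def pAttr (i : ℕ+) : ℕ+ → Bool := fun j => decide (j = i)

/-- `lᵢ(j) = 1` iff `j > i`. -/
def lAttr (i : ℕ+) : ℕ+ → Bool := fun j => decide (i < j)

theorem pAttr_injective : Function.Injective pAttr := by
  intro i j h
  have := congrFun h i
  simpa [pAttr] using this

theorem lAttr_injective : Function.Injective lAttr := by
  intro i j h
  have h1 := congrFun h i
  have h2 := congrFun h j
  simp only [lAttr, lt_irrefl, decide_false] at h1 h2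
  have h1' : ¬ j < i := by simpa using h1.symm
  have h2' : ¬ i < j := by simpa using h2
  exact le_antisymm (not_lt.mp h1') (not_lt.mp h2')

/-- The `i`-th coordinate of an infinite binary sequence. -/
def coordAttr (i : ℕ+) : (ℕ+ → Bool) → Bool := fun a => a i

theorem coordAttr_injective : Function.Injective coordAttr := by
  intro i j h
  have := congrFun h (pAttr j)
  simpa [coordAttr, pAttr] using this

/-- `U₁ = (ℕ, {lᵢ})` -/
def U₁ : InfoSystem.{0} where
  A := ℕ+
  F := Set.range lAttr
  infinite_A := inferInstance
  infinite_F := Set.infinite_range_of_injective lAttr_injective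

/-- `U₂ = (ℕ, {pᵢ} ∪ {l_{2^i}})` -/
def U₂ : InfoSystem.{0} where
  A := ℕ+
  F := Set.range pAttr ∪ Set.range fun i : ℕ+ => lAttr (2 ^ (i : ℕ))
  infinite_A := inferInstance
  infinite_F := (Set.infinite_range_of_injective pAttr_injective).mono Set.subset_union_left

/-- `U₃ = (ℕ, {pᵢ})` -/
def U₃ : InfoSystem.{0} where
  A := ℕ+
  F := Set.range pAttr
  infinite_A := inferInstance
  infinite_F := Set.infinite_range_of_injective pAttr_injective

/-- `U₄ = (ℕ, all functions ℕ → {0,1})` -/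
def U₄ : InfoSystem.{0} where
  A := ℕ+
  F := Set.univ
  infinite_A := inferInstance
  infinite_F := (Set.infinite_range_of_injective pAttr_injective).mono (Set.subset_univ _)

/-- `U₅`: infinite binary sequences with the coordinate functions. -/
def U₅ : InfoSystem.{0} where
  A := ℕ+ → Bool
  F := Set.range coordAttr
  infinite_A := Infinite.of_injective pAttr pAttr_injective
  infinite_F := Set.infinite_range_of_injective coordAttr_injective

/-! The table follows from independent dichotomies. Let N be the number of tuples in {0,1}^n
realized by n attributes. Querying the attributes one by one, and skipping those already decided,
gives a deterministic tree with at most 2N nodes. Conversely, a problem separating these tuples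
needs at least 2N nodes even nondeterministically (`two_mul_ncard_acceptedValues_le`), and
deterministic depth at least log₂ N. If I(U) = ∞, some n attributes realize all 2^n tuples. If I(U)
= d, the Sauer–Shelah lemma gives N ≤ (n+1)^d. Since F is infinite, N ≥ n+1 is always attainable.

Coverage lets every (n,U)-set with n ≥ m be covered by finitely many (m,U)-sets, so depth m suffices
nondeterministically. If coverage fails, then for each m ≥ 1 recognizing a suitable (m+1,U)-set
takes depth m+1: the accepting paths of a shallower tree would cover it by finitely many (m,U)-sets.
A deterministic tree of depth m has at most 2^m paths, so the same argument with t = 2^m handles the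
failure of restricted coverage.

The hard case is logarithmic depth under I(U) < ∞ and restricted coverage. Keep a finite set P of
representatives of the objects still possible. If some available attribute splits P in a balanced
way, query it. Otherwise the majority answers δ are wrong on less than a fraction 1/K of P for each
attribute: δ is dominant. The aim is a set G, containing the attributes X of the problem, such that
for every δ dominant on G at most m equations g = δ g imply f = δ f on all of X. Querying these m
attributes either meets a minority answer, which shrinks P, or settles the problem. The depth is
thus proportional to log |R|, where R represents the tuples realized on G, hence to log |G|.

For |X| = m+1 such a G collects the attributes of the (m,U)-sets given by restricted coverage
(`exists_certificateBound_succ`). Larger X are cut into blocks. For each dominant pattern on the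
block certificates, the equations chosen in the blocks are certified again
(`exists_certifies_union`). This stays affordable because there are only polynomially many dominant
patterns (`exists_card_dominantPatterns_le`). With k rounds per stage, multiplying log |X| by k
multiplies log |G| by O(k), and choosing k large makes this factor at most k^(1+ε), so log |G| =
O((log n)^(1+ε)). -/

/-! ### Paths in decision trees -/

namespace TreeNode

variable {α : Type u}

/-- The set of root-to-terminal paths of `t`, with the labels of their terminal nodes. -/
def paths (t : TreeNode α) : Set (List (α × Bool) × ℕ+) := {p | t.IsPath p.1 p.2}

theorem isPath_terminal_iff {d d' : ℕ+} {ξ : List (α × Bool)} :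
    (terminal d : TreeNode α).IsPath ξ d' ↔ ξ = [] ∧ d' = d := by
  constructor
  · rintro ⟨⟩
    exact ⟨rfl, rfl⟩
  · rintro ⟨rfl, rfl⟩
    exact .terminal _

theorem isPath_working_iff {f : α} {k : ℕ} {label : Fin (k + 1) → Bool}
    {child : Fin (k + 1) → TreeNode α} {ξ : List (α × Bool)} {d : ℕ+} :
    (working f k label child).IsPath ξ d ↔
      ∃ i ξ', ξ = (f, label i) :: ξ' ∧ (child i).IsPath ξ' d := by
  constructor
  · rintro ⟨⟩
    exact ⟨_, _, rfl, ‹_›⟩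
  · rintro ⟨i, ξ', rfl, h⟩
    exact .working _ _ _ _ _ _ _ h

theorem paths_terminal (d : ℕ+) : (terminal d : TreeNode α).paths = {([], d)} := by
  ext ⟨ξ, d'⟩
  simp [paths, isPath_terminal_iff]

theorem paths_working (f : α) (k : ℕ) (label : Fin (k + 1) → Bool)
    (child : Fin (k + 1) → TreeNode α) :
    (working f k label child).paths =
      ⋃ i, (fun p : List (α × Bool) × ℕ+ => ((f, label i) :: p.1, p.2)) '' (child i).paths := by
  ext ⟨ξ, d⟩
  simp only [paths, Set.mem_ofPred_eq, isPath_working_iff, Set.mem_iUnion, Set.mem_image,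
    Prod.exists, Prod.mk.injEq]
  constructor
  · rintro ⟨i, ξ', rfl, h⟩
    exact ⟨i, ξ', d, h, rfl, rfl⟩
  · rintro ⟨i, ξ', _, h, rfl, rfl⟩
    exact ⟨i, ξ', rfl, h⟩

theorem finite_paths (t : TreeNode α) : t.paths.Finite := by
  induction t with
  | terminal d => simp [paths_terminal]
  | working f k label child ih =>
    rw [paths_working]
    exact Set.finite_iUnion fun i => (ih i).image _

theorem length_le_depth (t : TreeNode α) {ξ : List (α × Bool)} {d : ℕ+} (h : t.IsPath ξ d) :
    ξ.length ≤ t.depth := by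
  induction h with
  | terminal d => simp
  | working f k label child i ξ d h ih =>
    simp only [List.length_cons, depth]
    have := Finset.le_sup (f := fun i => (child i).depth) (Finset.mem_univ i)
    omega

theorem encard_paths_le (t : TreeNode α) (h : t.Deterministic) :
    t.paths.encard ≤ ((2 ^ t.depth : ℕ) : ℕ∞) := by
  induction t with
  | terminal d => simp [paths_terminal, depth]
  | working f k label child ih =>
    obtain ⟨hinj, hc⟩ := h
    rw [paths_working]
    set s := Finset.univ.sup fun i => (child i).depth with hs
    have hk : k + 1 ≤ 2 := by simpa using Fintype.card_le_of_injective label hinj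
    calc (⋃ i, (fun p : List (α × Bool) × ℕ+ => ((f, label i) :: p.1, p.2)) ''
            (child i).paths).encard
        ≤ ∑ i, ((fun p : List (α × Bool) × ℕ+ => ((f, label i) :: p.1, p.2)) ''
            (child i).paths).encard :=
          Set.encard_iUnion_le_of_fintype _
      _ ≤ ∑ _i : Fin (k + 1), ((2 ^ s : ℕ) : ℕ∞) := by
          refine Finset.sum_le_sum fun i _ => (Set.encard_image_le _ _).trans ((ih i (hc i)).trans ?_)
          exact_mod_cast Nat.pow_le_pow_right (by norm_num)
            (Finset.le_sup (f := fun i => (child i).depth) (Finset.mem_univ i))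
      _ ≤ ((2 ^ (1 + s) : ℕ) : ℕ∞) := by
          rw [Finset.sum_const, Finset.card_univ, Fintype.card_fin, nsmul_eq_mul]
          norm_cast
          rw [pow_add, pow_one]
          exact Nat.mul_le_mul_right _ hk

end TreeNode

namespace DecisionTree

variable {α : Type u}

/-- The set of complete paths of `Γ`, with the labels of their terminal nodes. -/
def paths (Γ : DecisionTree α) : Set (List (α × Bool) × ℕ+) := {p | Γ.IsPath p.1 p.2}

theorem paths_eq (Γ : DecisionTree α) : Γ.paths = ⋃ i, (Γ.child i).paths := by
  ext p
  simp [paths, IsPath, TreeNode.paths]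

theorem finite_paths (Γ : DecisionTree α) : Γ.paths.Finite := by
  rw [paths_eq]
  exact Set.finite_iUnion fun i => (Γ.child i).finite_paths

theorem length_le_depth (Γ : DecisionTree α) {ξ : List (α × Bool)} {d : ℕ+} (h : Γ.IsPath ξ d) :
    ξ.length ≤ Γ.depth := by
  obtain ⟨i, hi⟩ := h
  exact ((Γ.child i).length_le_depth hi).trans
    (Finset.le_sup (f := fun i => (Γ.child i).depth) (Finset.mem_univ i))

theorem encard_paths_le (Γ : DecisionTree α) (h : Γ.Deterministic) :
    Γ.paths.encard ≤ ((2 ^ Γ.depth : ℕ) : ℕ∞) := by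
  obtain ⟨k, child⟩ := Γ
  obtain ⟨hk, hc⟩ := h
  simp only at hk
  subst hk
  have : (DecisionTree.mk 0 child).paths = (child 0).paths := by
    rw [paths_eq]
    ext p
    simp
  rw [this]
  refine ((child 0).encard_paths_le (hc 0)).trans ?_
  exact_mod_cast Nat.pow_le_pow_right (by norm_num)
    (Finset.le_sup (f := fun i => (child i).depth) (Finset.mem_univ 0))

end DecisionTree

/-! ### Acceptance, and upper bounds by successive queries -/

namespace InfoSystem

variable {U : InfoSystem.{u}}

/-- Some path of `t` that is compatible with `a` ends in a terminal node labelled `d`. -/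
def Accepts (t : TreeNode U.F) (a : U.A) (d : ℕ+) : Prop :=
  ∃ ξ, t.IsPath ξ d ∧ a ∈ U.solutions ξ

theorem accepts_terminal {a : U.A} {d d' : ℕ+} :
    Accepts (U := U) (.terminal d) a d' ↔ d' = d := by
  simp [Accepts, TreeNode.isPath_terminal_iff, solutions]

theorem accepts_working {f : U.F} {k : ℕ} {label : Fin (k + 1) → Bool}
    {child : Fin (k + 1) → TreeNode U.F} {a : U.A} {d : ℕ+} :
    Accepts (.working f k label child) a d ↔ ∃ i, f.1 a = label i ∧ Accepts (child i) a d := by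
  simp only [Accepts, TreeNode.isPath_working_iff]
  constructor
  · rintro ⟨ξ, ⟨i, ξ', rfl, h⟩, ha⟩
    exact ⟨i, ha _ List.mem_cons_self, ξ', h, fun e he => ha e (List.mem_cons_of_mem _ he)⟩
  · rintro ⟨i, hi, ξ, h, ha⟩
    refine ⟨_, ⟨i, ξ, rfl, h⟩, fun e he => ?_⟩
    rcases List.mem_cons.1 he with rfl | he
    · exact hi
    · exact ha e he

/-- Replaces paths by `Accepts`, which unfolds along the recursive structure of the tree. -/
theorem solvesNondet_iff {Γ : U.Tree} {z : U.Problem} :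
    SolvesNondet Γ z ↔ (∀ a, ∃ i, Accepts (Γ.child i) a (z.value a)) ∧
      ∀ a i d, Accepts (Γ.child i) a d → d = z.value a := by
  constructor
  · rintro ⟨h1, h2⟩
    refine ⟨fun a => ?_, fun a i d ⟨ξ, h, ha⟩ => h2 a ξ d ⟨i, h⟩ ha⟩
    obtain ⟨ξ, d, ⟨i, h⟩, ha⟩ := h1 a
    obtain rfl := h2 a ξ d ⟨i, h⟩ ha
    exact ⟨i, ξ, h, ha⟩
  · rintro ⟨h1, h2⟩
    refine ⟨fun a => ?_, fun a ξ d ⟨i, h⟩ ha => h2 a i d ⟨ξ, h, ha⟩⟩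
    obtain ⟨i, ξ, h, ha⟩ := h1 a
    exact ⟨ξ, _, ⟨i, h⟩, ha⟩

/-- On `B`, the function `v` is computed by a deterministic tree of depth at most `h` with at most
`s` nodes. -/
def SolvableOn (U : InfoSystem.{u}) (B : Set U.A) (v : U.A → ℕ+) (h s : ℕ) : Prop :=
  ∃ t : TreeNode U.F, t.Deterministic ∧ t.depth ≤ h ∧ t.size ≤ s ∧
    ∀ a ∈ B, ∀ d, Accepts t a d ↔ d = v a

namespace SolvableOn

variable {B C : Set U.A} {v : U.A → ℕ+} {h h' s s' : ℕ}

theorem mono (H : U.SolvableOn B v h s) (hC : C ⊆ B) (hh : h ≤ h') (hs : s ≤ s') :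
    U.SolvableOn C v h' s' := by
  obtain ⟨t, h1, h2, h3, h4⟩ := H
  exact ⟨t, h1, h2.trans hh, h3.trans hs, fun a ha => h4 a (hC ha)⟩

theorem leaf (hB : ∀ a ∈ B, ∀ b ∈ B, v a = v b) : U.SolvableOn B v 0 1 := by
  rcases B.eq_empty_or_nonempty with rfl | ⟨b, hb⟩
  · exact ⟨.terminal 1, trivial, le_rfl, le_rfl, by simp⟩
  · refine ⟨.terminal (v b), trivial, le_rfl, le_rfl, fun a ha d => ?_⟩
    rw [accepts_terminal, hB a ha b hb]

theorem query (f : U.F) (H : ∀ x, U.SolvableOn (B ∩ {a | f.1 a = x}) v h (if x then s' else s)) :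
    U.SolvableOn B v (h + 1) (s + s' + 1) := by
  choose t h1 h2 h3 h4 using H
  refine ⟨.working f 1 (fun i => i == 1) (fun i => t (i == 1)), ⟨?_, fun i => h1 _⟩, ?_, ?_, ?_⟩
  · intro i j
    fin_cases i <;> fin_cases j <;> simp
  · rw [TreeNode.depth, add_comm]
    exact Nat.add_le_add_right (Finset.sup_le fun i _ => h2 _) 1
  · rw [TreeNode.size, Fin.sum_univ_two]
    have h3f := h3 false
    have h3t := h3 true
    simp only [Bool.false_eq_true, if_false, if_true] at h3f h3t
    simp
    omega
  · intro a ha d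
    rw [accepts_working, ← h4 (f.1 a) a ⟨ha, rfl⟩ d]
    constructor
    · rintro ⟨i, hi, h⟩
      rwa [hi]
    · intro h
      cases hf : f.1 a <;> rw [hf] at h
      · exact ⟨0, by simp, h⟩
      · exact ⟨1, by simp, h⟩

theorem exists_solvesDet {z : U.Problem} (H : U.SolvableOn Set.univ z.value h s) :
    ∃ Γ : U.Tree, SolvesDet Γ z ∧ Γ.depth ≤ h ∧ Γ.size ≤ s + 1 := by
  obtain ⟨t, h1, h2, h3, h4⟩ := H
  refine ⟨⟨0, fun _ => t⟩, ⟨⟨rfl, fun _ => h1⟩, solvesNondet_iff.2 ⟨fun a => ⟨0, ?_⟩, ?_⟩⟩, ?_, ?_⟩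
  · exact (h4 a trivial _).2 rfl
  · exact fun a _ d => (h4 a trivial d).1
  · simpa [DecisionTree.depth] using h2
  · simp [DecisionTree.size]
    omega

theorem hd_le {z : U.Problem} (H : U.SolvableOn Set.univ z.value h s) : z.hd ≤ h := by
  obtain ⟨Γ, h1, h2, -⟩ := H.exists_solvesDet
  exact (iInf₂_le Γ h1).trans (by exact_mod_cast h2)

theorem Ld_le {z : U.Problem} (H : U.SolvableOn Set.univ z.value h s) :
    z.Ld ≤ ((s + 1 : ℕ) : ℕ∞) := by
  obtain ⟨Γ, h1, -, h2⟩ := H.exists_solvesDet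
  exact (iInf₂_le Γ h1).trans (by exact_mod_cast h2)

end SolvableOn

/-- The attributes are queried in order, but one that is constant on the current set is skipped.
Every working node then truly branches in two, and the leaves correspond to distinct realized
tuples; a binary tree with N leaves has 2N - 1 nodes. -/
theorem solvableOn_list (v : U.A → ℕ+) (l : List U.F) (B : Set U.A) (hB : B.Nonempty)
    (hv : ∀ a ∈ B, ∀ b ∈ B, (∀ f ∈ l, f.1 a = f.1 b) → v a = v b) :
    U.SolvableOn B v l.length (2 * ((fun a => l.map fun f => f.1 a) '' B).ncard - 1) := by
  have hfin : ∀ (l : List U.F) (B : Set U.A), ((fun a => l.map fun f => f.1 a) '' B).Finite := by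
    intro l B
    refine (List.finite_length_eq Bool l.length).subset ?_
    rintro _ ⟨a, -, rfl⟩
    exact List.length_map _
  induction l generalizing B with
  | nil =>
    have : ((fun a : U.A => ([] : List U.F).map fun f => f.1 a) '' B).ncard = 1 := by
      simp [hB.image_const]
    rw [this]
    exact SolvableOn.leaf fun a ha b hb => hv a ha b hb (by simp)
  | cons f l ih =>
    by_cases hx : ∃ x, ∀ a ∈ B, f.1 a = x
    · obtain ⟨x, hx⟩ := hx
      refine (ih B hB fun a ha b hb h => hv a ha b hb fun g hg => ?_).mono subset_rfl
        (Nat.le_succ _) (Nat.sub_le_sub_right (Nat.mul_le_mul_left 2 ?_) 1)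
      · rcases List.mem_cons.1 hg with rfl | hg
        · rw [hx a ha, hx b hb]
        · exact h g hg
      · have : (fun a : U.A => l.map fun f => f.1 a) '' B =
            List.tail '' ((fun a => (f :: l).map fun f => f.1 a) '' B) := by
          rw [Set.image_image]
          rfl
        rw [this]
        exact Set.ncard_image_le (hfin _ _)
    · push Not at hx
      have hne : ∀ x, (B ∩ {a | f.1 a = x}).Nonempty := by
        intro x
        obtain ⟨a, ha, hax⟩ := hx (!x)
        exact ⟨a, ha, by simpa using hax⟩
      have key := fun x => ih (B ∩ {a | f.1 a = x}) (hne x) fun a ha b hb h =>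
        hv a ha.1 b hb.1 fun g hg => by
          rcases List.mem_cons.1 hg with rfl | hg
          · rw [ha.2, hb.2]
          · exact h g hg
      -- Prepending the answer to `f` makes the tuples of the two branches disjoint, so their
      -- numbers add up.
      have hcard : ∑ x, ((fun a => l.map fun f => f.1 a) '' (B ∩ {a | f.1 a = x})).ncard ≤
          ((fun a => (f :: l).map fun f => f.1 a) '' B).ncard := by
        rw [Fintype.sum_bool]
        have hinj : ∀ x : Bool, Function.Injective (List.cons x) := fun x => List.cons_injective
        rw [← Set.ncard_image_of_injective (_ '' (B ∩ {a | f.1 a = true})) (hinj true),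
          ← Set.ncard_image_of_injective (_ '' (B ∩ {a | f.1 a = false})) (hinj false),
          ← Set.ncard_union_eq ?_ ((hfin _ _).image _) ((hfin _ _).image _)]
        · refine Set.ncard_le_ncard ?_ (hfin _ _)
          rintro _ (⟨_, ⟨a, ⟨ha, hax⟩, rfl⟩, rfl⟩ | ⟨_, ⟨a, ⟨ha, hax⟩, rfl⟩, rfl⟩)
          all_goals
            refine ⟨a, ha, ?_⟩
            rw [Set.mem_ofPred_eq] at hax
            simp [hax]
        · rw [Set.disjoint_left]
          rintro _ ⟨_, _, rfl⟩ ⟨_, _, h⟩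
          simp at h
      have hpos : ∀ x, 0 < ((fun a => l.map fun f => f.1 a) '' (B ∩ {a | f.1 a = x})).ncard :=
        fun x => (Set.ncard_pos (hfin _ _)).2 ((hne x).image _)
      have h0 := hpos false
      have h1 := hpos true
      rw [Fintype.sum_bool] at hcard
      refine (SolvableOn.query f
        (s := 2 * ((fun a => l.map fun f => f.1 a) '' (B ∩ {a | f.1 a = false})).ncard - 1)
        (s' := 2 * ((fun a => l.map fun f => f.1 a) '' (B ∩ {a | f.1 a = true})).ncard - 1)
        (h := l.length) fun x => ?_).mono subset_rfl le_rfl (by omega)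
      cases x
      · simpa using key false
      · simpa using key true

/-- The tuple of values of the attributes `f i` at `a`. -/
def tuple {ι : Type*} (f : ι → U.F) (a : U.A) : ι → Bool := fun i => (f i).1 a

theorem Problem.solvableOn (z : U.Problem) :
    U.SolvableOn Set.univ z.value z.dim (2 * (Set.range (tuple z.f)).ncard - 1) := by
  have := U.infinite_A
  have h := solvableOn_list z.value (List.ofFn z.f) Set.univ Set.univ_nonempty ?_
  · refine h.mono subset_rfl (by simp) (Nat.sub_le_sub_right (Nat.mul_le_mul_left 2 ?_) 1)
    have : (fun a : U.A => (List.ofFn z.f).map fun f => f.1 a) '' Set.univ =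
        List.ofFn '' Set.range (tuple z.f) := by
      rw [← Set.range_comp, Set.image_univ]
      congr 1
      funext a
      simp only [List.map_ofFn]
      rfl
    rw [this]
    exact Set.ncard_image_le (Set.toFinite _)
  · intro a _ b _ h
    simp only [Problem.value]
    congr 1
    funext i
    exact h _ (by simp [List.mem_ofFn])

theorem Problem.hd_le_dim (z : U.Problem) : z.hd ≤ z.dim := z.solvableOn.hd_le

theorem Problem.Ld_le (z : U.Problem) :
    z.Ld ≤ ((2 * (Set.range (tuple z.f)).ncard : ℕ) : ℕ∞) := by
  have := U.infinite_A
  refine z.solvableOn.Ld_le.trans ?_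
  have : 0 < (Set.range (tuple z.f)).ncard :=
    (Set.ncard_pos (Set.toFinite _)).2 (Set.range_nonempty _)
  norm_cast
  omega

theorem Problem.ha_le_hd (z : U.Problem) : z.ha ≤ z.hd :=
  le_iInf₂ fun Γ h => iInf₂_le Γ h.2

theorem Problem.La_le_Ld (z : U.Problem) : z.La ≤ z.Ld :=
  le_iInf₂ fun Γ h => iInf₂_le Γ h.2

theorem hd_le (n : ℕ) : U.hd n ≤ n :=
  iSup₂_le fun z hz => z.hd_le_dim.trans (by exact_mod_cast hz)

theorem ha_le (n : ℕ) : U.ha n ≤ n :=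
  iSup₂_le fun z hz => z.ha_le_hd.trans (z.hd_le_dim.trans (by exact_mod_cast hz))

theorem La_le_Ld (n : ℕ) : U.La n ≤ U.Ld n :=
  iSup₂_mono fun z _ => z.La_le_Ld

/-! ### Lower bounds -/

/-- The values of `v` on `B` that are attained at points accepted by the tree `t`. -/
def acceptedValues (v : U.A → ℕ+) (t : TreeNode U.F) (B : Set U.A) : Set ℕ+ :=
  v '' {a ∈ B | Accepts t a (v a)}

theorem acceptedValues_subset (v : U.A → ℕ+) (t : TreeNode U.F) (B : Set U.A) :
    acceptedValues v t B ⊆ v '' B :=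
  Set.image_mono (Set.sep_subset _ _)

/-- The bookkeeping for sibling subtrees that see the same objects. The extra 1 is granted only to a
sibling covering all of `V`; in that case the others add nothing, so the extra 1 is paid at most
once. -/
theorem two_mul_ncard_biUnion_le {ι β : Type*} (V : Set β) (hV : V.Finite) (s : Finset ι)
    (W : ι → Set β) (n : ι → ℕ) (hW : ∀ i ∈ s, W i ⊆ V)
    (h1 : ∀ i ∈ s, 2 * (W i).ncard ≤ n i + 1) (h2 : ∀ i ∈ s, W i ≠ V → 2 * (W i).ncard ≤ n i) :
    2 * (⋃ i ∈ s, W i).ncard ≤ ∑ i ∈ s, n i + 1 ∧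
      ((⋃ i ∈ s, W i) ≠ V → 2 * (⋃ i ∈ s, W i).ncard ≤ ∑ i ∈ s, n i) := by
  have hsub : (⋃ i ∈ s, W i) ⊆ V := Set.iUnion₂_subset hW
  by_cases h : ∃ i ∈ s, W i = V
  · obtain ⟨i, hi, rfl⟩ := h
    have heq : (⋃ j ∈ s, W j) = W i := hsub.antisymm (Set.subset_biUnion_of_mem (u := W) hi)
    rw [heq]
    refine ⟨(h1 i hi).trans ?_, fun h => absurd rfl h⟩
    exact Nat.add_le_add_right (Finset.single_le_sum (f := n) (fun _ _ => Nat.zero_le _) hi) 1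
  · push Not at h
    have : 2 * (⋃ i ∈ s, W i).ncard ≤ ∑ i ∈ s, n i := by
      refine (Nat.mul_le_mul_left 2 (Finset.set_ncard_biUnion_le s W)).trans ?_
      rw [Finset.mul_sum]
      exact Finset.sum_le_sum fun i hi => h2 i hi (h i hi)
    exact ⟨this.trans (Nat.le_succ _), fun _ => this⟩

/-- A nondeterministic tree may have unary nodes and repeated labels, so counting leaves is not
enough. The second, sharper inequality carries the induction: a subtree missing some value on `B`
loses the extra 1, as for a working node with only one label on its edges. -/
theorem two_mul_ncard_acceptedValues_le (v : U.A → ℕ+) (hv : (Set.range v).Finite)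
    (t : TreeNode U.F) (B : Set U.A) (hB : ∀ a ∈ B, ∀ d, Accepts t a d → d = v a) :
    2 * (acceptedValues v t B).ncard ≤ t.size + 1 ∧
      (acceptedValues v t B ≠ v '' B → 2 * (acceptedValues v t B).ncard ≤ t.size) := by
  have hfin : ∀ C : Set U.A, (v '' C).Finite := fun C => hv.subset (Set.image_subset_range _ _)
  induction t generalizing B with
  | terminal d =>
    have hsub : v '' B ⊆ {d} := by
      rintro _ ⟨a, ha, rfl⟩
      exact (hB a ha d (accepts_terminal.2 rfl)).symm
    have hacc : acceptedValues v (.terminal d) B = v '' B := by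
      refine (acceptedValues_subset _ _ _).antisymm ?_
      rintro _ ⟨a, ha, rfl⟩
      exact ⟨a, ⟨ha, accepts_terminal.2 (hsub ⟨a, ha, rfl⟩)⟩, rfl⟩
    rw [hacc]
    refine ⟨?_, fun h => absurd rfl h⟩
    have := Set.ncard_le_ncard hsub
    rw [Set.ncard_singleton] at this
    simp only [TreeNode.size]
    omega
  | working f k label child ih =>
    let s : Bool → Finset (Fin (k + 1)) := fun x => Finset.univ.filter fun i => label i = x
    let C : Bool → Set U.A := fun x => B ∩ {a | f.1 a = x}
    let W : Bool → Set ℕ+ := fun x => ⋃ i ∈ s x, acceptedValues v (child i) (C x)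
    -- The edges with a common label lead to subtrees seeing the same part of `B`, so they are
    -- merged first; then the two labels are added.
    have hgrp := fun x => two_mul_ncard_biUnion_le (v '' C x) (hfin _) (s x)
      (fun i => acceptedValues v (child i) (C x)) (fun i => (child i).size)
      (fun i _ => acceptedValues_subset _ _ _)
      (fun i hi => (ih i (C x) fun a ha d h => hB a ha.1 d
        (accepts_working.2 ⟨i, ha.2.trans (Finset.mem_filter.1 hi).2.symm, h⟩)).1)
      (fun i hi => (ih i (C x) fun a ha d h => hB a ha.1 d
        (accepts_working.2 ⟨i, ha.2.trans (Finset.mem_filter.1 hi).2.symm, h⟩)).2)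
    have hW : acceptedValues v (.working f k label child) B = W false ∪ W true := by
      ext y
      simp only [acceptedValues, W, C, s, Set.mem_union, Set.mem_iUnion, Set.mem_image,
        Set.mem_ofPred_eq, Finset.mem_filter, Finset.mem_univ, true_and, accepts_working,
        Set.mem_inter_iff, exists_prop]
      constructor
      · rintro ⟨a, ⟨ha, i, hi, h⟩, rfl⟩
        cases hx : label i
        · exact .inl ⟨i, hx, a, ⟨⟨ha, hi.trans hx⟩, h⟩, rfl⟩
        · exact .inr ⟨i, hx, a, ⟨⟨ha, hi.trans hx⟩, h⟩, rfl⟩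
      · rintro (⟨i, hx, a, ⟨⟨ha, hi⟩, h⟩, rfl⟩ | ⟨i, hx, a, ⟨⟨ha, hi⟩, h⟩, rfl⟩)
        · exact ⟨a, ⟨ha, i, hi.trans hx.symm, h⟩, rfl⟩
        · exact ⟨a, ⟨ha, i, hi.trans hx.symm, h⟩, rfl⟩
    have hV : v '' B = v '' C false ∪ v '' C true := by
      rw [← Set.image_union]
      congr 1
      ext a
      cases h : f.1 a <;> simp [C, h]
    have hsize : (TreeNode.working f k label child).size =
        1 + (∑ i ∈ s false, (child i).size + ∑ i ∈ s true, (child i).size) := by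
      rw [TreeNode.size]
      congr 1
      rw [← Finset.sum_filter_add_sum_filter_not Finset.univ (fun i => label i = false)]
      simp [s]
    have hle := Set.ncard_union_le (W false) (W true)
    rw [hsize, hW, hV]
    have h0 := hgrp false
    have h1 := hgrp true
    change 2 * (W false).ncard ≤ _ ∧ (W false ≠ _ → 2 * (W false).ncard ≤ _) at h0
    change 2 * (W true).ncard ≤ _ ∧ (W true ≠ _ → 2 * (W true).ncard ≤ _) at h1
    refine ⟨by omega, fun hne => ?_⟩
    -- If the union is not everything, one of the two groups is incomplete, and its sharper bound
    -- saves the unit needed.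
    by_cases hw : W false = v '' C false
    · have : W true ≠ v '' C true := fun h => hne (by rw [hw, h])
      have := h1.2 this
      omega
    · have := h0.2 hw
      omega

theorem Problem.finite_range_value (z : U.Problem) : (Set.range z.value).Finite :=
  (Set.finite_range z.ν).subset (by rintro _ ⟨a, rfl⟩; exact ⟨_, rfl⟩)

theorem Problem.two_mul_ncard_le_La (z : U.Problem) :
    ((2 * (Set.range z.value).ncard : ℕ) : ℕ∞) ≤ z.La := by
  refine le_iInf₂ fun Γ h => ?_
  rw [solvesNondet_iff] at h
  have := (two_mul_ncard_biUnion_le (Set.range z.value) z.finite_range_value Finset.univ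
    (fun i => acceptedValues z.value (Γ.child i) Set.univ) (fun i => (Γ.child i).size)
    (fun i _ => (acceptedValues_subset _ _ _).trans (Set.image_subset_range _ _))
    (fun i _ => (two_mul_ncard_acceptedValues_le _ z.finite_range_value _ _
      fun a _ d => h.2 a i d).1)
    (fun i _ => by
      have := (two_mul_ncard_acceptedValues_le _ z.finite_range_value (Γ.child i) Set.univ
        fun a _ d => h.2 a i d).2
      rwa [Set.image_univ] at this)).1
  have heq : (⋃ i ∈ Finset.univ, acceptedValues z.value (Γ.child i) Set.univ) =
      Set.range z.value := by
    refine (Set.iUnion₂_subset fun i _ =>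
      (acceptedValues_subset _ _ _).trans (Set.image_subset_range _ _)).antisymm ?_
    rintro _ ⟨a, rfl⟩
    obtain ⟨i, hi⟩ := h.1 a
    exact Set.mem_biUnion (Finset.mem_univ i) ⟨a, ⟨trivial, hi⟩, rfl⟩
  rw [heq] at this
  rw [DecisionTree.size]
  exact_mod_cast this.trans (by omega)

theorem Problem.ncard_le_two_pow (z : U.Problem) {Γ : U.Tree} (h : SolvesDet Γ z) :
    (Set.range z.value).ncard ≤ 2 ^ Γ.depth := by
  have hsub : Set.range z.value ⊆ Prod.snd '' Γ.paths := by
    rintro _ ⟨a, rfl⟩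
    obtain ⟨ξ, d, hp, ha⟩ := h.2.1 a
    exact ⟨(ξ, d), hp, h.2.2 a ξ d hp ha⟩
  have h1 := (Set.encard_le_encard hsub).trans
    ((Set.encard_image_le _ _).trans (Γ.encard_paths_le h.1))
  rw [← z.finite_range_value.cast_ncard_eq] at h1
  exact_mod_cast h1

/-- The hypothesis says that there are more than 2^(k-1) values, written without subtraction. -/
theorem Problem.le_hd (z : U.Problem) {k : ℕ} (h : 2 ^ k < 2 * (Set.range z.value).ncard) :
    (k : ℕ∞) ≤ z.hd := by
  refine le_iInf₂ fun Γ hΓ => ?_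
  have h1 := z.ncard_le_two_pow hΓ
  have h2 : 2 ^ k < 2 ^ (Γ.depth + 1) := by
    rw [pow_succ]
    omega
  have := (Nat.pow_lt_pow_iff_right (by norm_num)).1 h2
  exact_mod_cast Nat.lt_succ_iff.1 this

/-- A problem distinguishing all values of the tuple of attributes `f`. -/
noncomputable def separatingProblem {n : ℕ} (hn : 1 ≤ n) (f : Fin n → U.F) : U.Problem where
  dim := n
  dim_pos := hn
  ν := fun x => (Fintype.equivFin (Fin n → Bool) x : ℕ).succPNat
  f := f

theorem ncard_range_separatingProblem {n : ℕ} (hn : 1 ≤ n) (f : Fin n → U.F) :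
    (Set.range (separatingProblem hn f).value).ncard = (Set.range (tuple f)).ncard := by
  have : Set.range (separatingProblem hn f).value =
      (separatingProblem hn f).ν '' Set.range (tuple f) := by
    rw [← Set.range_comp]
    rfl
  rw [this]
  refine Set.ncard_image_of_injective _ fun x y h => ?_
  have h' := Nat.succPNat_injective h
  exact (Fintype.equivFin (Fin n → Bool)).injective (Fin.ext h')

/-- Otherwise every attribute would be a function of the tuple of `f`, and there are only finitely
many such functions. -/
theorem exists_attribute_splitting {n : ℕ} (f : Fin n → U.F) :
    ∃ g : U.F, ∃ a b, tuple f a = tuple f b ∧ g.1 a ≠ g.1 b := by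
  by_contra! h
  refine U.infinite_F ?_
  have hfac : ∀ g ∈ U.F, ∃ φ : (Fin n → Bool) → Bool, g = φ ∘ tuple f := by
    intro g hg
    have := U.infinite_A
    refine ⟨fun x => g (Function.invFun (tuple f) x), ?_⟩
    funext a
    refine h ⟨g, hg⟩ _ _ ?_
    exact (Function.invFun_eq ⟨a, rfl⟩).symm
  refine (Set.finite_range fun φ : (Fin n → Bool) → Bool => φ ∘ tuple f).subset fun g hg => ?_
  obtain ⟨φ, rfl⟩ := hfac g hg
  exact ⟨φ, rfl⟩

theorem exists_lt_ncard_range_tuple (U : InfoSystem.{u}) (n : ℕ) :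
    ∃ f : Fin n → U.F, n + 1 ≤ (Set.range (tuple f)).ncard := by
  have := U.infinite_A
  induction n with
  | zero =>
    exact ⟨Fin.elim0, (Set.ncard_pos (Set.toFinite _)).2 (Set.range_nonempty _)⟩
  | succ n ih =>
    obtain ⟨f, hf⟩ := ih
    obtain ⟨g, a, b, hab, hg⟩ := exists_attribute_splitting f
    refine ⟨Fin.cons g f, ?_⟩
    have htail : ∀ a, Fin.tail (tuple (Fin.cons g f : Fin (n + 1) → U.F) a) = tuple f a :=
      fun a => rfl
    have himg : Fin.tail '' Set.range (tuple (Fin.cons g f : Fin (n + 1) → U.F)) =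
        Set.range (tuple f) := by
      rw [← Set.range_comp]
      rfl
    have hle : (Set.range (tuple f)).ncard ≤
        (Set.range (tuple (Fin.cons g f : Fin (n + 1) → U.F))).ncard := by
      rw [← himg]
      exact Set.ncard_image_le (Set.toFinite _)
    -- Forgetting the new coordinate maps the new tuples onto the old ones. With equal counts this
    -- map would be injective, although `g` separates two objects with the same old tuple.
    rcases hle.lt_or_eq with hlt | heq
    · omega
    · rw [← himg] at heq
      have hinj := Set.injOn_of_ncard_image_eq heq (Set.toFinite _)
      have := hinj ⟨a, rfl⟩ ⟨b, rfl⟩ (by rw [htail, htail, hab])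
      exact absurd (congrFun this 0) hg

theorem exists_surjective_tuple (h : U.iDim = ⊤) (n : ℕ) :
    ∃ f : Fin n → U.F, Function.Surjective (tuple f) := by
  have hlt : ((n : ℕ) : ℕ∞) < U.iDim := by
    rw [h]
    exact ENat.natCast_lt_top n
  rw [iDim] at hlt
  simp only [lt_iSup_iff] at hlt
  obtain ⟨S, ⟨hS, hind⟩, hn⟩ := hlt
  have hn : n ≤ S.card := by exact_mod_cast hn.le
  let e : Fin n → S := fun i => S.equivFin.symm (Fin.castLE hn i)
  have he : Function.Injective e := S.equivFin.symm.injective.comp (Fin.castLE_injective hn)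
  refine ⟨fun i => ⟨(e i).1, hS (e i).2⟩, fun x => ?_⟩
  classical
  obtain ⟨a, ha⟩ := hind fun g => if hg : ∃ i, (e i).1 = g then x hg.choose else false
  refine ⟨a, funext fun i => ?_⟩
  have hi : ∃ j, (e j).1 = (e i).1 := ⟨i, rfl⟩
  have := ha (e i).1 (e i).2
  rw [dif_pos hi] at this
  rw [tuple, this]
  congr 1
  exact he (Subtype.ext hi.choose_spec)

theorem le_La (n : ℕ) (hn : 1 ≤ n) (f : Fin n → U.F) :
    ((2 * (Set.range (tuple f)).ncard : ℕ) : ℕ∞) ≤ U.La n := by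
  rw [← ncard_range_separatingProblem hn f]
  exact (Problem.two_mul_ncard_le_La _).trans
    (le_iSup₂_of_le (separatingProblem hn f) (le_refl n) le_rfl)

theorem le_hd {n k : ℕ} (hn : 1 ≤ n) (f : Fin n → U.F)
    (h : 2 ^ k < 2 * (Set.range (tuple f)).ncard) : (k : ℕ∞) ≤ U.hd n := by
  rw [← ncard_range_separatingProblem hn f] at h
  exact (Problem.le_hd _ h).trans (le_iSup₂_of_le (separatingProblem hn f) (le_refl n) le_rfl)

theorem ncard_range_tuple_of_surjective {n : ℕ} {f : Fin n → U.F}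
    (hf : Function.Surjective (tuple f)) : (Set.range (tuple f)).ncard = 2 ^ n := by
  rw [hf.range_eq, Set.ncard_univ]
  simp

theorem Ld_le_two_pow (n : ℕ) : U.Ld n ≤ ((2 ^ (n + 1) : ℕ) : ℕ∞) := by
  refine iSup₂_le fun z hz => z.Ld_le.trans ?_
  have h1 : (Set.range (tuple z.f)).ncard ≤ 2 ^ z.dim := by
    refine (Set.ncard_le_ncard (Set.subset_univ _)).trans ?_
    simp [Set.ncard_univ]
  have h2 : 2 ^ z.dim ≤ 2 ^ n := Nat.pow_le_pow_right (by norm_num) hz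
  rw [pow_succ]
  exact_mod_cast (by omega)

theorem hd_eq_of_iDim_eq_top (h : U.iDim = ⊤) (n : ℕ) (hn : 1 ≤ n) : U.hd n = n := by
  refine (hd_le n).antisymm ?_
  obtain ⟨f, hf⟩ := exists_surjective_tuple h n
  refine le_hd hn f ?_
  rw [ncard_range_tuple_of_surjective hf]
  have : 0 < 2 ^ n := by positivity
  omega

theorem two_pow_le_La (h : U.iDim = ⊤) (n : ℕ) (hn : 1 ≤ n) :
    ((2 ^ (n + 1) : ℕ) : ℕ∞) ≤ U.La n := by
  obtain ⟨f, hf⟩ := exists_surjective_tuple h n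
  have := le_La n hn f
  rwa [ncard_range_tuple_of_surjective hf, ← pow_succ'] at this

theorem La_eq_of_iDim_eq_top (h : U.iDim = ⊤) (n : ℕ) (hn : 1 ≤ n) :
    U.La n = ((2 ^ (n + 1) : ℕ) : ℕ∞) :=
  ((La_le_Ld n).trans (Ld_le_two_pow n)).antisymm (two_pow_le_La h n hn)

theorem Ld_eq_of_iDim_eq_top (h : U.iDim = ⊤) (n : ℕ) (hn : 1 ≤ n) :
    U.Ld n = ((2 ^ (n + 1) : ℕ) : ℕ∞) :=
  (Ld_le_two_pow n).antisymm ((two_pow_le_La h n hn).trans (La_le_Ld n))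

theorem linear_le_La (U : InfoSystem.{u}) (n : ℕ) (hn : 1 ≤ n) :
    ((2 * (n + 1) : ℕ) : ℕ∞) ≤ U.La n := by
  obtain ⟨f, hf⟩ := U.exists_lt_ncard_range_tuple n
  refine le_trans ?_ (le_La n hn f)
  exact_mod_cast Nat.mul_le_mul_left 2 hf

/-! ### The number of realized tuples -/

theorem sum_choose_le_pow (n d : ℕ) : ∑ i ∈ Finset.range (d + 1), n.choose i ≤ (n + 1) ^ d := by
  rw [add_pow]
  refine Finset.sum_le_sum fun i hi => ?_
  have h1 : n.choose i ≤ n ^ i := Nat.choose_le_pow n i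
  have h2 : 0 < d.choose i := Nat.choose_pos (Nat.lt_succ_iff.1 (Finset.mem_range.1 hi))
  rw [one_pow, mul_one]
  exact h1.trans (Nat.le_mul_of_pos_right _ h2)

/-- Sauer–Shelah in Pajor's form: a family has at most as many members as sets it shatters, and here
these have at most `d` elements. -/
theorem card_le_pow_of_shatters {α : Type*} [DecidableEq α] (Y : Finset α)
    (𝒜 : Finset (Finset α)) (d : ℕ) (hY : ∀ S ∈ 𝒜, S ⊆ Y)
    (hd : ∀ S, 𝒜.Shatters S → S.card ≤ d) : 𝒜.card ≤ (Y.card + 1) ^ d := by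
  refine (Finset.card_le_card_shatterer 𝒜).trans (le_trans ?_ (sum_choose_le_pow Y.card d))
  have hsub : 𝒜.shatterer ⊆ (Finset.range (d + 1)).biUnion fun i => Y.powersetCard i := by
    intro S hS
    rw [Finset.mem_shatterer] at hS
    obtain ⟨T, hT, hST⟩ := hS.exists_superset
    simp only [Finset.mem_biUnion, Finset.mem_range, Finset.mem_powersetCard]
    exact ⟨S.card, Nat.lt_succ_iff.2 (hd S hS), hST.trans (hY T hT), rfl⟩
  refine (Finset.card_le_card hsub).trans (Finset.card_biUnion_le.trans ?_)
  simp [Finset.card_powersetCard]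

theorem card_le_of_independent {d : ℕ} (hd : U.iDim ≤ d) {S : Finset (U.A → Bool)}
    (hS : (S : Set (U.A → Bool)) ⊆ U.F) (hind : U.Independent S) : S.card ≤ d := by
  have : (S.card : ℕ∞) ≤ U.iDim := le_iSup₂_of_le S ⟨hS, hind⟩ le_rfl
  exact_mod_cast this.trans hd

theorem ncard_range_tuple_le {ι : Type*} [Fintype ι] {d : ℕ} (hd : U.iDim ≤ d) (f : ι → U.F) :
    (Set.range (tuple f)).ncard ≤ (Fintype.card ι + 1) ^ d := by
  classical
  let 𝒜 : Finset (Finset ι) := Finset.univ.filter fun S => ∃ a, ∀ i, i ∈ S ↔ (f i).1 a = true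
  have h1 : (Set.range (tuple f)).ncard ≤ 𝒜.card := by
    have : Set.range (tuple f) ⊆ (fun (S : Finset ι) i => decide (i ∈ S)) '' (𝒜 : Set (Finset ι)) := by
      rintro _ ⟨a, rfl⟩
      refine ⟨Finset.univ.filter fun i => (f i).1 a = true, ?_, ?_⟩
      · simp only [𝒜, Finset.coe_filter, Finset.mem_univ, true_and, Set.mem_ofPred_eq]
        exact ⟨a, by simp⟩
      · funext i
        simp [tuple]
    refine (Set.ncard_le_ncard this (Set.toFinite _)).trans ?_
    refine (Set.ncard_image_le (Set.toFinite _)).trans ?_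
    rw [Set.ncard_coe_finset]
  refine h1.trans (card_le_pow_of_shatters Finset.univ 𝒜 d (fun S _ => Finset.subset_univ S) ?_)
  intro S hS
  have hreal : ∀ T ⊆ S, ∃ a, ∀ i ∈ S, ((f i).1 a = true ↔ i ∈ T) := by
    intro T hT
    obtain ⟨R, hR, rfl⟩ := hS hT
    obtain ⟨a, ha⟩ := (Finset.mem_filter.1 hR).2
    exact ⟨a, fun i hi => by simp [← ha, hi]⟩
  -- `f` may repeat attributes, but two indices with the same attribute cannot lie in a shattered
  -- set, since the pattern {i} separates them.
  have hinj : Set.InjOn (fun i => (f i).1) S := by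
    intro i hi j hj hij
    obtain ⟨a, ha⟩ := hreal {i} (by simpa using hi)
    have h1 := (ha i hi).2 (by simp)
    have h2 := (ha j hj).1 (by rw [← h1]; exact (congrFun hij a).symm)
    exact (Finset.mem_singleton.1 h2).symm
  rw [← Finset.card_image_of_injOn hinj]
  refine card_le_of_independent hd ?_ fun δ => ?_
  · intro g hg
    simp only [Finset.coe_image, Set.mem_image] at hg
    obtain ⟨i, -, rfl⟩ := hg
    exact (f i).2
  · obtain ⟨a, ha⟩ := hreal (S.filter fun i => δ (f i).1 = true) (Finset.filter_subset _ _)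
    refine ⟨a, fun g hg => ?_⟩
    obtain ⟨i, hi, rfl⟩ := Finset.mem_image.1 hg
    rw [Bool.eq_iff_iff, ha i hi]
    simp [hi]

theorem Ld_le_of_iDim {d : ℕ} (hd : U.iDim ≤ d) (n : ℕ) (hn : 1 ≤ n) :
    U.Ld n ≤ ((2 * (4 * n) ^ d : ℕ) : ℕ∞) := by
  refine iSup₂_le fun z hz => z.Ld_le.trans ?_
  have h1 := ncard_range_tuple_le hd z.f
  rw [Fintype.card_fin] at h1
  have h2 : (z.dim + 1) ^ d ≤ (4 * n) ^ d := Nat.pow_le_pow_left (by omega) d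
  exact_mod_cast Nat.mul_le_mul_left 2 (h1.trans h2)

/-! ### Nondeterministic trees from coverings -/

/-- The tree consisting of one path, with equations `ξ` and terminal label `d`. -/
def chainTree (d : ℕ+) : List (U.F × Bool) → TreeNode U.F
  | [] => .terminal d
  | e :: ξ => .working e.1 0 (fun _ => e.2) fun _ => chainTree d ξ

theorem depth_chainTree (d : ℕ+) (ξ : List (U.F × Bool)) : (chainTree d ξ).depth = ξ.length := by
  induction ξ with
  | nil => rfl
  | cons e ξ ih => simp [chainTree, TreeNode.depth, ih, add_comm]

theorem solutions_cons (e : U.F × Bool) (ξ : List (U.F × Bool)) :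
    U.solutions (e :: ξ) = {a | e.1.1 a = e.2} ∩ U.solutions ξ := by
  ext a
  simp [solutions]

theorem accepts_chainTree (d : ℕ+) (ξ : List (U.F × Bool)) (a : U.A) (d' : ℕ+) :
    Accepts (chainTree d ξ) a d' ↔ a ∈ U.solutions ξ ∧ d' = d := by
  induction ξ with
  | nil => simp [chainTree, accepts_terminal, solutions]
  | cons e ξ ih =>
    rw [chainTree, accepts_working, solutions_cons]
    simp [ih, and_assoc]

theorem Problem.ha_le_of_cover {z : U.Problem} {m : ℕ} (S : Set (List (U.F × Bool)))
    (hS : S.Finite) (hm : ∀ ξ ∈ S, ξ.length ≤ m) (hcov : ∀ a, ∃ ξ ∈ S, a ∈ U.solutions ξ)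
    (hz : ∀ ξ ∈ S, ∀ a ∈ U.solutions ξ, ∀ b ∈ U.solutions ξ, z.value a = z.value b) :
    z.ha ≤ m := by
  classical
  have := U.infinite_A
  obtain ⟨ξ₀, hξ₀, -⟩ := hcov (Classical.arbitrary U.A)
  have := hS.fintype
  have : Nonempty S := ⟨⟨ξ₀, hξ₀⟩⟩
  obtain ⟨k, hk⟩ := Nat.exists_eq_succ_of_ne_zero (Fintype.card_ne_zero (α := S))
  let e : Fin (k + 1) ≃ S := (finCongr hk.symm).trans (Fintype.equivFin S).symm
  -- A path with contradictory equations is followed by no object, so its label 1 is arbitrary.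
  let lab : S → ℕ+ := fun ξ => if h : (U.solutions ξ.1).Nonempty then z.value h.some else 1
  have hlab : ∀ ξ : S, ∀ a ∈ U.solutions ξ.1, lab ξ = z.value a := by
    intro ξ a ha
    have h : (U.solutions ξ.1).Nonempty := ⟨a, ha⟩
    simp only [lab, dif_pos h]
    exact hz ξ.1 ξ.2 _ h.some_mem _ ha
  let Γ : U.Tree := ⟨k, fun i => chainTree (lab (e i)) (e i).1⟩
  have hΓ : SolvesNondet Γ z := by
    rw [solvesNondet_iff]
    constructor
    · intro a
      obtain ⟨ξ, hξ, ha⟩ := hcov a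
      refine ⟨e.symm ⟨ξ, hξ⟩, ?_⟩
      rw [accepts_chainTree, e.apply_symm_apply]
      exact ⟨ha, (hlab ⟨ξ, hξ⟩ a ha).symm⟩
    · intro a i d h
      rw [accepts_chainTree] at h
      rw [h.2]
      exact hlab _ a h.1
  refine (iInf₂_le Γ hΓ).trans ?_
  have : Γ.depth ≤ m := Finset.sup_le fun i _ => by
    rw [depth_chainTree]
    exact hm _ (e i).2
  exact_mod_cast this

theorem IsMSet.exists_solutions {m : ℕ} {B : Set U.A} (h : U.IsMSet m B) :
    ∃ ξ : List (U.F × Bool), ξ.length = m ∧ U.solutions ξ = B := by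
  obtain ⟨-, f, δ, rfl⟩ := h
  refine ⟨List.ofFn fun i => (f i, δ i), by simp, ?_⟩
  ext a
  simp [solutions, List.mem_ofFn]

theorem IsMSet.pad {k m : ℕ} (hk : 1 ≤ k) (hkm : k ≤ m) {B : Set U.A} (h : U.IsMSet k B) :
    U.IsMSet m B := by
  obtain ⟨hB, f, δ, rfl⟩ := h
  -- The last equation is repeated, which requires at least one equation.
  let r : Fin m → Fin k := fun i => ⟨min i (k - 1), by omega⟩
  refine ⟨hB, f ∘ r, δ ∘ r, ?_⟩
  ext a
  constructor
  · exact fun h i => h (r i)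
  · intro h i
    have := h ⟨i, by omega⟩
    have hr : r ⟨i, by omega⟩ = i := by
      ext
      simp only [r]
      omega
    simpa [hr] using this

theorem isMSet_solutions {m : ℕ} {ξ : List (U.F × Bool)} (hne : ξ ≠ []) (hm : ξ.length ≤ m)
    (h : (U.solutions ξ).Nonempty) : U.IsMSet m (U.solutions ξ) := by
  refine IsMSet.pad (k := ξ.length) (List.length_pos_iff.2 hne) hm ⟨h, fun i => ξ[i].1,
    fun i => ξ[i].2, ?_⟩
  ext a
  constructor
  · exact fun ha i => ha _ (List.getElem_mem _)
  · intro ha e he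
    obtain ⟨i, hi, rfl⟩ := List.getElem_of_mem he
    exact ha ⟨i, hi⟩

/-- The equations of an `(n+1,U)`-set split into an `(n,U)`-set and one equation. -/
theorem IsMSet.exists_inter {n : ℕ} {B : Set U.A} (h : U.IsMSet (n + 1) B) :
    ∃ B' : Set U.A, ∃ (g : U.F) (x : Bool), U.IsMSet n B' ∧ B = B' ∩ {a | g.1 a = x} := by
  obtain ⟨hB, f, δ, rfl⟩ := h
  refine ⟨{a | ∀ i : Fin n, (f i.castSucc).1 a = δ i.castSucc}, f (Fin.last n), δ (Fin.last n),
    ⟨hB.imp fun a ha i => ha i.castSucc, _, _, rfl⟩, ?_⟩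
  ext a
  simp [Fin.forall_fin_succ']

theorem IsMSet.inter {n : ℕ} {B : Set U.A} (h : U.IsMSet n B) (g : U.F) (x : Bool)
    (hne : (B ∩ {a | g.1 a = x}).Nonempty) : U.IsMSet (n + 1) (B ∩ {a | g.1 a = x}) := by
  obtain ⟨-, f, δ, rfl⟩ := h
  refine ⟨hne, Fin.snoc f g, Fin.snoc δ x, ?_⟩
  ext a
  simp [Fin.forall_fin_succ']

/-- One equation is added at a time: each nonempty piece of the current cover becomes an (m+1,U)-set
and is covered again. -/
theorem exists_finite_cover {m : ℕ} (hcov : ∀ B, U.IsMSet (m + 1) B →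
      ∃ C : Set (Set U.A), C.Finite ∧ (∀ D ∈ C, U.IsMSet m D) ∧ B = ⋃₀ C)
    {n : ℕ} (hn : m ≤ n) (B : Set U.A) (hB : U.IsMSet n B) :
    ∃ C : Set (Set U.A), C.Finite ∧ (∀ D ∈ C, U.IsMSet m D) ∧ B = ⋃₀ C := by
  induction n, hn using Nat.le_induction generalizing B with
  | base => exact ⟨{B}, Set.finite_singleton B, by simpa using hB, by simp⟩
  | succ n hn ih =>
    obtain ⟨B', g, x, hB', rfl⟩ := hB.exists_inter
    obtain ⟨C, hC, hCm, rfl⟩ := ih B' hB'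
    have H : ∀ D : Set U.A, ∃ C' : Set (Set U.A), C'.Finite ∧
        (D ∈ C → (∀ E ∈ C', U.IsMSet m E) ∧ D ∩ {a | g.1 a = x} = ⋃₀ C') := by
      intro D
      by_cases hD : D ∈ C ∧ (D ∩ {a | g.1 a = x}).Nonempty
      · obtain ⟨C', h1, h2, h3⟩ := hcov _ ((hCm D hD.1).inter g x hD.2)
        exact ⟨C', h1, fun _ => ⟨h2, h3⟩⟩
      · refine ⟨∅, Set.finite_empty, fun hDC => ⟨by simp, ?_⟩⟩
        rw [Set.sUnion_empty, ← Set.not_nonempty_iff_eq_empty]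
        exact fun h => hD ⟨hDC, h⟩
    choose C' h1 h2 using H
    refine ⟨⋃ D ∈ C, C' D, hC.biUnion fun D _ => h1 D, ?_, ?_⟩
    · intro E hE
      obtain ⟨D, hD, hE⟩ := Set.mem_iUnion₂.1 hE
      exact (h2 D hD).1 E hE
    · ext a
      constructor
      · rintro ⟨⟨D, hD, ha⟩, hax⟩
        have : a ∈ ⋃₀ C' D := (h2 D hD).2 ▸ ⟨ha, hax⟩
        obtain ⟨E, hE, haE⟩ := this
        exact ⟨E, Set.mem_iUnion₂.2 ⟨D, hD, hE⟩, haE⟩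
      · rintro ⟨E, hE, haE⟩
        obtain ⟨D, hD, hE⟩ := Set.mem_iUnion₂.1 hE
        have : a ∈ D ∩ {a | g.1 a = x} := (h2 D hD).2 ▸ ⟨E, hE, haE⟩
        exact ⟨⟨D, hD, this.1⟩, this.2⟩

theorem Coverage.exists_ha_le (h : U.Coverage) : ∃ c : ℕ, 0 < c ∧ ∀ n : ℕ, 1 ≤ n → U.ha n ≤ c := by
  obtain ⟨m, hm, hcov⟩ := h
  refine ⟨m, hm, fun n _ => iSup₂_le fun z _ => ?_⟩
  by_cases hz : z.dim ≤ m
  · exact z.ha_le_hd.trans (z.hd_le_dim.trans (by exact_mod_cast hz))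
  push Not at hz
  have H : ∀ x : Fin z.dim → Bool, ∃ S : Set (List (U.F × Bool)), S.Finite ∧
      (∀ ξ ∈ S, ξ.length ≤ m) ∧ {a | ∀ i, (z.f i).1 a = x i} = ⋃ ξ ∈ S, U.solutions ξ := by
    intro x
    by_cases hx : {a | ∀ i, (z.f i).1 a = x i}.Nonempty
    · obtain ⟨C, hC, hCm, hCB⟩ := exists_finite_cover hcov hz.le _ ⟨hx, z.f, x, rfl⟩
      have : ∀ D : C, ∃ ξ : List (U.F × Bool), ξ.length = m ∧ U.solutions ξ = D :=
        fun D => (hCm D.1 D.2).exists_solutions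
      choose ξ h1 h2 using this
      have := hC.to_subtype
      refine ⟨Set.range ξ, Set.finite_range ξ, ?_, ?_⟩
      · rintro _ ⟨D, rfl⟩
        exact (h1 D).le
      · rw [hCB, Set.sUnion_eq_iUnion, Set.biUnion_range]
        simp only [h2]
    · exact ⟨∅, Set.finite_empty, by simp, by simpa using Set.not_nonempty_iff_eq_empty.1 hx⟩
  choose S h1 h2 h3 using H
  refine Problem.ha_le_of_cover (⋃ x, S x) (Set.finite_iUnion h1) ?_ ?_ ?_
  · intro ξ hξ
    obtain ⟨x, hx⟩ := Set.mem_iUnion.1 hξ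
    exact h2 x ξ hx
  · intro a
    have : a ∈ {b | ∀ i, (z.f i).1 b = (z.f i).1 a} := fun i => rfl
    rw [h3 fun i => (z.f i).1 a] at this
    obtain ⟨ξ, hξ, ha⟩ := Set.mem_iUnion₂.1 this
    exact ⟨ξ, Set.mem_iUnion.2 ⟨_, hξ⟩, ha⟩
  · intro ξ hξ a ha b hb
    obtain ⟨x, hx⟩ := Set.mem_iUnion.1 hξ
    have hsub : ∀ c ∈ U.solutions ξ, c ∈ {c | ∀ i, (z.f i).1 c = x i} := by
      intro c hc
      rw [h3 x]
      exact Set.mem_iUnion₂.2 ⟨ξ, hx, hc⟩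
    simp only [Problem.value]
    congr 1
    funext i
    rw [hsub a ha i, hsub b hb i]

/-! ### Recognizing an `(m+1,U)`-set -/

/-- The problem of recognizing the solutions of the system `f i = δ i`. -/
def recognitionProblem {n : ℕ} (hn : 1 ≤ n) (f : Fin n → U.F) (δ : Fin n → Bool) : U.Problem where
  dim := n
  dim_pos := hn
  ν := fun x => if x = δ then 1 else 2
  f := f

theorem recognitionProblem_value {n : ℕ} (hn : 1 ≤ n) (f : Fin n → U.F) (δ : Fin n → Bool)
    (a : U.A) : 1 = (recognitionProblem hn f δ).value a ↔ ∀ i, (f i).1 a = δ i := by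
  by_cases h : (fun i => (f i).1 a) = δ
  · simp only [Problem.value, recognitionProblem, h, if_true, true_iff]
    exact fun i => congrFun h i
  · simp only [Problem.value, recognitionProblem, h, if_false]
    refine iff_of_false (by decide) fun h' => h (funext h')

/-- The realizable paths labelled 1 have at most `m` equations, and their solution sets make up the
recognized set. Taking `C` inside the image of `Γ.paths` keeps control of the number of pieces. -/
theorem exists_cover_of_depth_le {m : ℕ} (f : Fin (m + 1) → U.F)
    (δ : Fin (m + 1) → Bool) {Γ : U.Tree}
    (hΓ : SolvesNondet Γ (recognitionProblem (Nat.le_add_left 1 m) f δ)) (hdep : Γ.depth ≤ m) :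
    ∃ C ⊆ (fun p : List (U.F × Bool) × ℕ+ => U.solutions p.1) '' Γ.paths,
      (∀ D ∈ C, U.IsMSet m D) ∧ {a | ∀ i, (f i).1 a = δ i} = ⋃₀ C := by
  refine ⟨(fun p : List (U.F × Bool) × ℕ+ => U.solutions p.1) ''
    {p ∈ Γ.paths | p.2 = 1 ∧ (U.solutions p.1).Nonempty}, Set.image_mono (Set.sep_subset _ _),
    ?_, ?_⟩
  · rintro _ ⟨⟨ξ, d⟩, ⟨hp, rfl, hne⟩, rfl⟩
    simp only at hne ⊢
    -- An empty path has no equation to repeat. But then all objects satisfy the system, and its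
    -- first `m` equations already define the universe.
    by_cases hξ : ξ = []
    · subst hξ
      have huniv : ∀ a i, (f i).1 a = δ i := fun a =>
        (recognitionProblem_value _ f δ a).1 (hΓ.2 a [] 1 hp (by simp [solutions]))
      refine ⟨hne, fun i => f i.castSucc, fun i => δ i.castSucc, ?_⟩
      ext a
      simp [solutions, huniv]
    · exact isMSet_solutions hξ ((Γ.length_le_depth hp).trans hdep) hne
  · ext a
    constructor
    · intro ha
      obtain ⟨ξ, d, hp, hax⟩ := hΓ.1 a
      have hd := hΓ.2 a ξ d hp hax
      rw [← (recognitionProblem_value _ f δ a).2 ha] at hd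
      subst hd
      exact ⟨_, ⟨(ξ, 1), ⟨hp, rfl, a, hax⟩, rfl⟩, hax⟩
    · rintro ⟨_, ⟨⟨ξ, d⟩, ⟨hp, rfl, -⟩, rfl⟩, ha⟩
      exact (recognitionProblem_value _ f δ a).1 (hΓ.2 a ξ 1 hp ha)

/-- Covers n = 1 in the linear lower bounds, since both coverage conditions only concern m ≥ 1. -/
theorem one_le_ha_one (U : InfoSystem.{u}) : 1 ≤ U.ha 1 := by
  obtain ⟨g, a, b, -, hab⟩ := U.exists_attribute_splitting (Fin.elim0 : Fin 0 → U.F)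
  let z : U.Problem := recognitionProblem le_rfl (fun _ : Fin 1 => g) fun _ => g.1 a
  refine le_trans ?_ (le_iSup₂_of_le z le_rfl le_rfl)
  refine le_iInf₂ fun Γ hΓ => ?_
  by_contra! h
  have hdep : Γ.depth = 0 := by
    have : Γ.depth < 1 := by exact_mod_cast h
    omega
  obtain ⟨ξ, d, hp, ha⟩ := hΓ.1 a
  have hξ : ξ = [] := by
    have := Γ.length_le_depth hp
    rw [hdep] at this
    exact List.length_eq_zero_iff.1 (Nat.le_zero.1 this)
  subst hξ
  have h1 := hΓ.2 a [] d hp ha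
  have h2 := hΓ.2 b [] d hp (by simp [solutions])
  have h3 : 1 = z.value a := (recognitionProblem_value _ _ _ a).2 fun _ => rfl
  rw [← h1, h2] at h3
  exact hab ((recognitionProblem_value _ _ _ b).1 h3 0).symm

theorem ha_eq_of_not_coverage (h : ¬ U.Coverage) (n : ℕ) (hn : 1 ≤ n) : U.ha n = n := by
  refine (ha_le n).antisymm ?_
  rcases hn.eq_or_lt with rfl | hn'
  · exact_mod_cast U.one_le_ha_one
  obtain ⟨m, rfl⟩ : ∃ m, n = m + 1 := ⟨n - 1, by omega⟩
  have hm : 1 ≤ m := by omega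
  unfold Coverage at h
  push Not at h
  obtain ⟨B, ⟨-, f, δ, rfl⟩, hB⟩ := h m hm
  refine le_trans ?_ (le_iSup₂_of_le (recognitionProblem (Nat.le_add_left 1 m) f δ) le_rfl le_rfl)
  refine le_iInf₂ fun Γ hΓ => ?_
  by_contra! hlt
  have hdep : Γ.depth < m + 1 := by exact_mod_cast hlt
  obtain ⟨C, hC, hCm, hCB⟩ := exists_cover_of_depth_le f δ hΓ (Nat.lt_succ_iff.1 hdep)
  exact hB C ((Γ.finite_paths.image _).subset hC) hCm hCB

theorem hd_eq_of_not_restrictedCoverage (h : ¬ U.RestrictedCoverage) (n : ℕ) (hn : 1 ≤ n) :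
    U.hd n = n := by
  refine (hd_le n).antisymm ?_
  rcases hn.eq_or_lt with rfl | hn'
  · exact (by exact_mod_cast U.one_le_ha_one : ((1 : ℕ) : ℕ∞) ≤ U.ha 1).trans
      (iSup₂_mono fun z _ => z.ha_le_hd)
  obtain ⟨m, rfl⟩ : ∃ m, n = m + 1 := ⟨n - 1, by omega⟩
  have hm : 1 ≤ m := by omega
  unfold RestrictedCoverage at h
  push Not at h
  -- The bound 2^m is the maximal number of complete paths in a deterministic tree of depth m.
  obtain ⟨B, ⟨-, f, δ, rfl⟩, hB⟩ := h m (2 ^ m) hm Nat.one_le_two_pow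
  refine le_trans ?_ (le_iSup₂_of_le (recognitionProblem (Nat.le_add_left 1 m) f δ) le_rfl le_rfl)
  refine le_iInf₂ fun Γ hΓ => ?_
  by_contra! hlt
  have hdep : Γ.depth < m + 1 := by exact_mod_cast hlt
  obtain ⟨C, hC, hCm, hCB⟩ := exists_cover_of_depth_le f δ hΓ.2 (Nat.lt_succ_iff.1 hdep)
  refine hB C ?_ hCm hCB
  refine (Set.encard_le_encard hC).trans ((Set.encard_image_le _ _).trans
    ((Γ.encard_paths_le hΓ.1).trans ?_))
  exact_mod_cast Nat.pow_le_pow_right (by norm_num) (Nat.lt_succ_iff.1 hdep)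

theorem RestrictedCoverage.coverage (h : U.RestrictedCoverage) : U.Coverage := by
  obtain ⟨m, t, hm, -, H⟩ := h
  refine ⟨m, hm, fun B hB => ?_⟩
  obtain ⟨C, hC, h1, h2⟩ := H B hB
  exact ⟨C, Set.finite_of_encard_le_coe hC, h1, h2⟩

/-! ### Dominant patterns and certificates -/

/-- `δ` predicts each attribute of `G` correctly at all but less than a fraction `1/K` of the points
of some common nonempty finite set. -/
def Dominant (K : ℕ) (δ : U.F → Bool) (G : Finset U.F) : Prop :=
  ∃ P : Finset U.A, P.Nonempty ∧ ∀ g ∈ G, K * (P.filter fun a => g.1 a ≠ δ g).card < P.card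

/-- `G` certifies `X`: if `δ` is dominant on `G`, then at most `m` of the equations `g = δ g` with
`g ∈ G` imply all the equations `f = δ f` with `f ∈ X`. -/
def Certifies (K m : ℕ) (G X : Finset U.F) : Prop :=
  X ⊆ G ∧ ∀ δ, Dominant K δ G → ∃ E ⊆ G, E.card ≤ m ∧
    ∀ a, (∀ g ∈ E, g.1 a = δ g) → ∀ f ∈ X, f.1 a = δ f

/-- Every set of at most `p` attributes is certified by a set of at most `2 ^ L` attributes. -/
def CertificateBound (U : InfoSystem.{u}) (K m p L : ℕ) : Prop :=
  ∀ X : Finset U.F, X.card ≤ p → ∃ G, Certifies K m G X ∧ G.card ≤ 2 ^ L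

variable {K m : ℕ}

theorem Dominant.mono {δ : U.F → Bool} {G H : Finset U.F} (h : Dominant K δ G) (hH : H ⊆ G) :
    Dominant K δ H := by
  obtain ⟨P, hP, h⟩ := h
  exact ⟨P, hP, fun g hg => h g (hH hg)⟩

theorem Dominant.congr {δ δ' : U.F → Bool} {G : Finset U.F} (h : Dominant K δ G)
    (hδ : ∀ g ∈ G, δ g = δ' g) : Dominant K δ' G := by
  obtain ⟨P, hP, h⟩ := h
  exact ⟨P, hP, fun g hg => by rw [← hδ g hg]; exact h g hg⟩

/-- Union bound: at most K attributes, each mispredicted on less than |P|/K points, leave a point of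
P where all predictions hold. -/
theorem Dominant.exists_eq {δ : U.F → Bool} {G : Finset U.F} (h : Dominant K δ G)
    (hG : G.card ≤ K) : ∃ a, ∀ g ∈ G, g.1 a = δ g := by
  classical
  obtain ⟨P, hP, h⟩ := h
  by_contra! hne
  have hsub : P ⊆ G.biUnion fun g => P.filter fun a => g.1 a ≠ δ g := by
    intro a ha
    obtain ⟨g, hg, hga⟩ := hne a
    exact Finset.mem_biUnion.2 ⟨g, hg, Finset.mem_filter.2 ⟨ha, hga⟩⟩
  have hcard := (Finset.card_le_card hsub).trans Finset.card_biUnion_le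
  have hGne : G.Nonempty := by
    obtain ⟨a, ha⟩ := hP
    obtain ⟨g, hg, -⟩ := hne a
    exact ⟨g, hg⟩
  have h1 : K * P.card < K * P.card := calc
    K * P.card ≤ K * ∑ g ∈ G, (P.filter fun a => g.1 a ≠ δ g).card := Nat.mul_le_mul_left _ hcard
    _ = ∑ g ∈ G, K * (P.filter fun a => g.1 a ≠ δ g).card := Finset.mul_sum _ _ _
    _ < ∑ _g ∈ G, P.card := Finset.sum_lt_sum_of_nonempty hGne h
    _ = G.card * P.card := by simp
    _ ≤ K * P.card := Nat.mul_le_mul_right _ hG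
  exact lt_irrefl _ h1

/-! ### The number of dominant patterns -/

/-- Double counting of mispredictions: averaged over P, a point disagrees with δ on at most |Z|/K =
e attributes. -/
theorem Dominant.exists_card_le {δ : U.F → Bool} {Z : Finset U.F} {e : ℕ} (h : Dominant K δ Z)
    (hZ : Z.card = K * e) : ∃ a, (Z.filter fun g => g.1 a ≠ δ g).card ≤ e := by
  obtain ⟨P, hP, h⟩ := h
  by_contra! hne
  have h1 : P.card * (e + 1) ≤ ∑ a ∈ P, (Z.filter fun g => g.1 a ≠ δ g).card := by
    rw [← smul_eq_mul]
    exact Finset.card_nsmul_le_sum _ _ _ fun a _ => hne a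
  have h2 : ∑ a ∈ P, (Z.filter fun g => g.1 a ≠ δ g).card =
      ∑ g ∈ Z, (P.filter fun a => g.1 a ≠ δ g).card := by
    simp only [Finset.card_filter]
    exact Finset.sum_comm
  have h3 : ∑ g ∈ Z, K * (P.filter fun a => g.1 a ≠ δ g).card ≤ Z.card * P.card := by
    rw [← smul_eq_mul (Z.card)]
    exact Finset.sum_le_card_nsmul _ _ _ fun g hg => (h g hg).le
  rw [← Finset.mul_sum, ← h2, hZ] at h3
  have hPpos := hP.card_pos
  rcases Nat.eq_zero_or_pos K with rfl | hK
  · obtain rfl : Z = ∅ := by simpa using hZ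
    obtain ⟨a, -⟩ := hP
    have := hne a
    simp at this
  · have h4 : K * (P.card * (e + 1)) ≤ K * e * P.card := (Nat.mul_le_mul_left K h1).trans h3
    have h5 : K * (P.card * (e + 1)) = K * e * P.card + K * P.card := by ring
    have h6 : 0 < K * P.card := Nat.mul_pos hK hPpos
    omega

/-- A bound for Hamming balls: with weights 4^(|Z|-|T|), all subsets weigh (1+4)^|Z| together, and
each small one at least 4^(|Z|-e). -/
theorem card_filter_card_le_mul {α : Type*} (Z : Finset α) (e : ℕ) :
    (Z.powerset.filter fun T => T.card ≤ e).card * 4 ^ (Z.card - e) ≤ 5 ^ Z.card := by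
  calc (Z.powerset.filter fun T => T.card ≤ e).card * 4 ^ (Z.card - e)
      ≤ ∑ T ∈ Z.powerset.filter (fun T => T.card ≤ e), 1 ^ T.card * 4 ^ (Z.card - T.card) := by
        rw [← smul_eq_mul]
        refine Finset.card_nsmul_le_sum _ _ _ fun T hT => ?_
        rw [one_pow, one_mul]
        have := (Finset.mem_filter.1 hT).2
        exact Nat.pow_le_pow_right (by norm_num) (by omega)
    _ ≤ ∑ T ∈ Z.powerset, 1 ^ T.card * 4 ^ (Z.card - T.card) :=
        Finset.sum_le_sum_of_subset (Finset.filter_subset _ _)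
    _ = 5 ^ Z.card := Finset.sum_pow_mul_eq_add_pow 1 4 Z

open Classical in
/-- The sets of attributes `S ⊆ Y` whose indicator function is dominant on `Y`. -/
noncomputable def dominantPatterns (K : ℕ) (Y : Finset U.F) : Finset (Finset U.F) :=
  Y.powerset.filter fun S => Dominant K (fun g => decide (g ∈ S)) Y

theorem mem_dominantPatterns [DecidableEq U.F] {Y S : Finset U.F} :
    S ∈ dominantPatterns K Y ↔ S ⊆ Y ∧ Dominant K (fun g => decide (g ∈ S)) Y := by
  classical
  rw [dominantPatterns, Finset.mem_filter, Finset.mem_powerset]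
  refine and_congr_right fun _ => iff_of_eq ?_
  congr!

/-- Every subset of a shattered Z is within Hamming distance e of a trace realized by an object. It
is recovered from that trace and the error set, so 2^|Z| is at most the number of traces times the
size of a ball of radius e. -/
theorem pow_le_of_shatters [DecidableEq U.F] {d e : ℕ} (hd : U.iDim ≤ d) {Y Z : Finset U.F}
    (hZ : (dominantPatterns K Y).Shatters Z) (hcard : Z.card = K * e) :
    2 ^ (K * e) * 4 ^ (K * e - e) ≤ (K * e + 1) ^ d * 5 ^ (K * e) := by
  have hZY : Z ⊆ Y := by
    obtain ⟨T, hT, hZT⟩ := hZ.exists_superset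
    exact hZT.trans (mem_dominantPatterns.1 hT).1
  have H : ∀ S : Finset U.F, ∃ a, S ⊆ Z → (Z.filter fun g => g.1 a ≠ decide (g ∈ S)).card ≤ e := by
    intro S
    by_cases hS : S ⊆ Z
    · obtain ⟨T, hT, rfl⟩ := hZ hS
      have hdom := (mem_dominantPatterns.1 hT).2
      obtain ⟨a, ha⟩ := ((hdom.mono hZY).congr (δ' := fun g => decide (g ∈ Z ∩ T))
        (fun g hg => by simp [hg])).exists_card_le hcard
      exact ⟨a, fun _ => ha⟩
    · have := U.infinite_A
      exact ⟨Classical.arbitrary _, fun h => absurd h hS⟩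
  choose a ha using H
  let tr := (Set.toFinite (Set.range (tuple (Subtype.val : Z → U.F)))).toFinset
  have htr : tr.card ≤ (K * e + 1) ^ d := by
    have := ncard_range_tuple_le hd (Subtype.val : Z → U.F)
    rwa [Set.ncard_eq_toFinset_card _ (Set.toFinite _), Fintype.card_coe, hcard] at this
  have hle : Z.powerset.card ≤ (tr ×ˢ Z.powerset.filter fun T => T.card ≤ e).card := by
    refine Finset.card_le_card_of_injOn (fun S => (tuple (Subtype.val : Z → U.F) (a S),
      Z.filter fun g => g.1 (a S) ≠ decide (g ∈ S))) ?_ ?_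
    · intro S hS
      have hS' : S ⊆ Z := by simpa using hS
      simp only [Finset.coe_product, Set.mem_prod, Finset.mem_coe, Finset.mem_filter,
        Finset.mem_powerset]
      exact ⟨(Set.Finite.mem_toFinset _).2 ⟨_, rfl⟩, Finset.filter_subset _ _, ha S hS'⟩
    · intro S hS T hT h
      have hS' : S ⊆ Z := by simpa using hS
      have hT' : T ⊆ Z := by simpa using hT
      obtain ⟨h1, h2⟩ := Prod.mk.inj h
      ext g
      by_cases hg : g ∈ Z
      · have e1 : g.1 (a S) = g.1 (a T) := congrFun h1 ⟨g, hg⟩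
        have e2 := Finset.ext_iff.1 h2 g
        simp only [Finset.mem_filter, hg, true_and, e1] at e2
        by_cases hgS : g ∈ S <;> by_cases hgT : g ∈ T <;> simp_all
      · exact ⟨fun h => absurd (hS' h) hg, fun h => absurd (hT' h) hg⟩
  rw [Finset.card_powerset, Finset.card_product, hcard] at hle
  have hball := card_filter_card_le_mul Z e
  rw [hcard] at hball
  calc 2 ^ (K * e) * 4 ^ (K * e - e)
      ≤ (tr.card * (Z.powerset.filter fun T => T.card ≤ e).card) * 4 ^ (K * e - e) :=
        Nat.mul_le_mul_right _ hle
    _ = tr.card * ((Z.powerset.filter fun T => T.card ≤ e).card * 4 ^ (K * e - e)) := mul_assoc _ _ _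
    _ ≤ (K * e + 1) ^ d * 5 ^ (K * e) := Nat.mul_le_mul htr hball

theorem eventually_pow_lt_pow (C d : ℕ) {r : ℝ} (hr : 1 < r) :
    ∀ᶠ n : ℕ in Filter.atTop, ((C * n : ℕ) : ℝ) ^ d < r ^ n := by
  have h := (tendsto_pow_const_div_const_pow_of_one_lt d hr).const_mul ((C : ℝ) ^ d)
  rw [mul_zero] at h
  filter_upwards [h.eventually (gt_mem_nhds one_pos)] with n hn
  have hpos : (0 : ℝ) < r ^ n := by positivity
  rw [← mul_div_assoc, div_lt_one hpos] at hn
  rw [Nat.cast_mul, mul_pow]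
  exact hn

theorem six_mul_five_pow_le (hK : 4 ≤ K) : 6 * 5 ^ K ≤ 8 ^ K := by
  induction K, hK using Nat.le_induction with
  | base => norm_num
  | succ k hk ih =>
    rw [pow_succ, pow_succ]
    omega

/-- After multiplication by 4^e the left side is less than (6·5^K)^e, once e is so large that
(Ke+1)^d < (3/2)^e. The inequality 6·5^K ≤ 8^K is what requires K ≥ 4. -/
theorem exists_lt_of_four_le (hK : 4 ≤ K) (d : ℕ) :
    ∃ e : ℕ, (K * e + 1) ^ d * 5 ^ (K * e) < 2 ^ (K * e) * 4 ^ (K * e - e) := by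
  obtain ⟨e, he, he1⟩ := ((eventually_pow_lt_pow (K + 1) d
    (by norm_num : (1 : ℝ) < 3 / 2)).and (Filter.eventually_ge_atTop 1)).exists
  refine ⟨e, ?_⟩
  have h1 : (K * e + 1) ^ d * 2 ^ e < 3 ^ e := by
    rw [div_pow, lt_div_iff₀ (by positivity)] at he
    have he' : ((K + 1) * e) ^ d * 2 ^ e < 3 ^ e := by exact_mod_cast he
    refine lt_of_le_of_lt (Nat.mul_le_mul_right _ (Nat.pow_le_pow_left ?_ d)) he'
    nlinarith
  have h3 : 6 ^ e * 5 ^ (K * e) ≤ 8 ^ (K * e) := by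
    rw [pow_mul, pow_mul, ← mul_pow]
    exact Nat.pow_le_pow_left (six_mul_five_pow_le hK) e
  have h4 : 2 ^ (K * e) * 4 ^ (K * e - e) * 4 ^ e = 8 ^ (K * e) := by
    rw [mul_assoc, ← pow_add, Nat.sub_add_cancel (Nat.le_mul_of_pos_left e (by omega)), ← mul_pow]
    norm_num
  have h5 : (K * e + 1) ^ d * 5 ^ (K * e) * 4 ^ e < 8 ^ (K * e) := by
    refine lt_of_lt_of_le ?_ h3
    have : (K * e + 1) ^ d * 5 ^ (K * e) * 4 ^ e =
        ((K * e + 1) ^ d * 2 ^ e) * (2 ^ e * 5 ^ (K * e)) := by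
      rw [show (4 : ℕ) = 2 * 2 by norm_num, mul_pow]
      ring
    rw [this, show (6 : ℕ) = 3 * 2 by norm_num, mul_pow, mul_assoc (3 ^ e)]
    exact Nat.mul_lt_mul_of_pos_right h1 (show 0 < 2 ^ e * 5 ^ (K * e) by positivity)
  rw [← h4] at h5
  exact lt_of_mul_lt_mul_right h5 (Nat.zero_le _)

theorem exists_card_dominantPatterns_le (hK : 4 ≤ K) {d : ℕ} (hd : U.iDim ≤ d) :
    ∃ q : ℕ, 1 ≤ q ∧ ∀ Y : Finset U.F, (dominantPatterns K Y).card ≤ (Y.card + 1) ^ q := by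
  classical
  obtain ⟨e, he⟩ := exists_lt_of_four_le hK d
  -- A shattered set has fewer than K·e elements; the larger exponent only ensures q ≥ 1.
  refine ⟨K * e + 1, Nat.le_add_left _ _, fun Y => ?_⟩
  refine card_le_pow_of_shatters Y _ _
    (fun S hS => (mem_dominantPatterns.1 hS).1) fun S hS => ?_
  by_contra! hlt
  obtain ⟨Z, hZS, hZ⟩ := Finset.exists_subset_card_eq (show K * e ≤ S.card by omega)
  exact absurd (pow_le_of_shatters hd (hS.mono_right hZS) hZ) (not_le.2 he)

/-! ### Composition of certificates -/

/-- The equations that certify the blocks depend on δ, but only through its pattern on the union Y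
of the block certificates. So one recertifying set is prepared for each dominant pattern on Y. The
attributes of `Z` are passed unchanged to the second round. -/
theorem exists_certifies_union {q : ℕ}
    (hq : ∀ Y : Finset U.F, (dominantPatterns K Y).card ≤ (Y.card + 1) ^ q)
    [DecidableEq U.F] {ι : Type*} (B : Finset ι) (X G : ι → Finset U.F) (Z : Finset U.F)
    (hG : ∀ b ∈ B, Certifies K m (G b) (X b)) {s : ℕ}
    (hs : ∀ X' : Finset U.F, X'.card ≤ m * B.card + Z.card →
      ∃ G', Certifies K m G' X' ∧ G'.card ≤ s) :
    ∃ H, Certifies K m H (B.biUnion X ∪ Z) ∧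
      H.card ≤ (B.biUnion G).card + Z.card + ((B.biUnion G).card + 1) ^ q * s := by
  set Y := B.biUnion G with hY
  have h1 : ∀ (S : Finset U.F) (b : ι), ∃ E : Finset U.F, S ∈ dominantPatterns K Y → b ∈ B →
      E ⊆ G b ∧ E.card ≤ m ∧
        ∀ a, (∀ g ∈ E, g.1 a = decide (g ∈ S)) → ∀ f ∈ X b, f.1 a = decide (f ∈ S) := by
    intro S b
    by_cases h : S ∈ dominantPatterns K Y ∧ b ∈ B
    · have hdom := (mem_dominantPatterns.1 h.1).2
      obtain ⟨E, hE⟩ := (hG b h.2).2 _ (hdom.mono (Finset.subset_biUnion_of_mem G h.2))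
      exact ⟨E, fun _ _ => hE⟩
    · exact ⟨∅, fun h1 h2 => absurd ⟨h1, h2⟩ h⟩
  choose E hE using h1
  have h2 : ∀ S : Finset U.F, ∃ G', S ∈ dominantPatterns K Y →
      Certifies K m G' (B.biUnion (E S) ∪ Z) ∧ G'.card ≤ s := by
    intro S
    by_cases h : S ∈ dominantPatterns K Y
    · obtain ⟨G', hG'⟩ := hs (B.biUnion (E S) ∪ Z) <| by
        refine (Finset.card_union_le _ _).trans (Nat.add_le_add_right ?_ _)
        rw [mul_comm]
        exact Finset.card_biUnion_le_card_mul _ _ _ fun b hb => (hE S b h hb).2.1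
      exact ⟨G', fun _ => hG'⟩
    · exact ⟨∅, fun h' => absurd h' h⟩
  choose G' hG' using h2
  refine ⟨Y ∪ Z ∪ (dominantPatterns K Y).biUnion G', ⟨?_, fun δ hδ => ?_⟩, ?_⟩
  · refine Finset.union_subset ?_ ?_
    · refine Finset.biUnion_subset.2 fun b hb => (hG b hb).1.trans ?_
      exact (Finset.subset_biUnion_of_mem G hb).trans
        (Finset.subset_union_left.trans Finset.subset_union_left)
    · exact Finset.subset_union_right.trans Finset.subset_union_left
  -- The pattern of the actual δ on Y selects the second-round certificate. Its equations imply
  -- those chosen in each block, which imply the equations on the block.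
  · set S := Y.filter fun g => δ g = true with hS
    have hSδ : ∀ g ∈ Y, δ g = decide (g ∈ S) := by
      intro g hg
      simp [hS, hg]
    have hSmem : S ∈ dominantPatterns K Y := by
      refine mem_dominantPatterns.2 ⟨Finset.filter_subset _ _, (hδ.mono ?_).congr hSδ⟩
      exact Finset.subset_union_left.trans Finset.subset_union_left
    obtain ⟨hcert, -⟩ := hG' S hSmem
    have hsub : G' S ⊆ Y ∪ Z ∪ (dominantPatterns K Y).biUnion G' :=
      (Finset.subset_biUnion_of_mem G' hSmem).trans Finset.subset_union_right
    obtain ⟨D, hD, hDm, hDa⟩ := hcert.2 δ (hδ.mono hsub)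
    refine ⟨D, hD.trans hsub, hDm, fun a ha f hf => ?_⟩
    have hX' := hDa a ha
    rcases Finset.mem_union.1 hf with hf | hf
    · obtain ⟨b, hb, hfb⟩ := Finset.mem_biUnion.1 hf
      obtain ⟨e1, -, e3⟩ := hE S b hSmem hb
      have hGY : G b ⊆ Y := Finset.subset_biUnion_of_mem G hb
      rw [hSδ f (hGY ((hG b hb).1 hfb))]
      refine e3 a (fun g hg => ?_) f hfb
      rw [← hSδ g (hGY (e1 hg))]
      exact hX' g (Finset.mem_union_left _ (Finset.mem_biUnion.2 ⟨b, hb, hg⟩))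
    · exact hX' f (Finset.mem_union_right _ hf)
  · refine (Finset.card_union_le _ _).trans (Nat.add_le_add (Finset.card_union_le _ _) ?_)
    refine (Finset.card_biUnion_le_card_mul _ _ s fun S hS => (hG' S hS).2).trans ?_
    exact Nat.mul_le_mul_right _ (hq Y)

theorem exists_blocks {α : Type*} [DecidableEq α] (p q : ℕ) (X : Finset α) (hX : X.card ≤ p * q) :
    ∃ Xb : ℕ → Finset α, (∀ i, (Xb i).card ≤ p) ∧ X = (Finset.range q).biUnion Xb := by
  induction q generalizing X with
  | zero =>
    refine ⟨fun _ => ∅, by simp, ?_⟩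
    simpa using hX
  | succ q ih =>
    obtain ⟨T, hTX, hT⟩ := Finset.exists_subset_card_eq (Nat.min_le_right p X.card)
    obtain ⟨Xb, h1, h2⟩ := ih (X \ T) <| by
      rw [Finset.card_sdiff_of_subset hTX, hT]
      rw [mul_add, mul_one] at hX
      omega
    refine ⟨fun i => if i = q then T else Xb i, fun i => ?_, ?_⟩
    · dsimp only
      split_ifs
      · omega
      · exact h1 i
    · rw [Finset.range_add_one, Finset.biUnion_insert, if_pos rfl]
      have : (Finset.range q).biUnion (fun i => if i = q then T else Xb i) =
          (Finset.range q).biUnion Xb := by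
        refine Finset.biUnion_congr rfl fun i hi => ?_
        rw [if_neg (Finset.mem_range.1 hi).ne]
      rw [this, ← h2, Finset.union_sdiff_of_subset hTX]

namespace CertificateBound

theorem mono {p p' L : ℕ} (h : U.CertificateBound K m p L) (hp : p' ≤ p) :
    U.CertificateBound K m p' L :=
  fun X hX => h X (hX.trans hp)

/-- 2^b blocks of size p contribute m·2^b equations to recertify. The factor q falls on L alone,
while L' enters additively. -/
theorem mul {q : ℕ} (hq1 : 1 ≤ q)
    (hq : ∀ Y : Finset U.F, (dominantPatterns K Y).card ≤ (Y.card + 1) ^ q) {p b L L' : ℕ}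
    (h : U.CertificateBound K m p L) (h' : U.CertificateBound K m (m * 2 ^ b) L') :
    U.CertificateBound K m (p * 2 ^ b) ((b + L + 1) * q + L' + 1) := by
  classical
  intro X hX
  obtain ⟨Xb, h1, rfl⟩ := exists_blocks p (2 ^ b) X hX
  choose G hG hGc using fun i => h (Xb i) (h1 i)
  obtain ⟨H, hH, hHc⟩ := exists_certifies_union hq (Finset.range (2 ^ b)) Xb G ∅
    (fun i _ => hG i) (s := 2 ^ L') (fun X' hX' => h' X' (by simpa using hX'))
  rw [Finset.union_empty] at hH
  refine ⟨H, hH, hHc.trans ?_⟩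
  have hY : ((Finset.range (2 ^ b)).biUnion G).card ≤ 2 ^ (b + L) := by
    refine (Finset.card_biUnion_le_card_mul _ _ (2 ^ L) fun i _ => hGc i).trans ?_
    rw [Finset.card_range, pow_add]
  have h2 : ((Finset.range (2 ^ b)).biUnion G).card + 1 ≤ 2 ^ (b + L + 1) := by
    have : 1 ≤ 2 ^ (b + L) := Nat.one_le_two_pow
    rw [pow_succ]
    omega
  have h3 : (((Finset.range (2 ^ b)).biUnion G).card + 1) ^ q * 2 ^ L' ≤
      2 ^ ((b + L + 1) * q + L') := by
    rw [pow_add, pow_mul]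
    exact Nat.mul_le_mul_right _ (Nat.pow_le_pow_left h2 q)
  have h4 : 2 ^ (b + L) ≤ 2 ^ ((b + L + 1) * q + L') := by
    refine Nat.pow_le_pow_right (by norm_num) ?_
    nlinarith
  rw [Finset.card_empty, pow_succ]
  omega

/-- Attributes are added one at a time: the old set contributes at most m equations, and with the
new attribute there are m+1 to recertify. The growth in p is irrelevant, as only one fixed p is
needed later. -/
theorem exists_of_succ {q : ℕ}
    (hq : ∀ Y : Finset U.F, (dominantPatterns K Y).card ≤ (Y.card + 1) ^ q) {L₀ : ℕ}
    (h₀ : U.CertificateBound K m (m + 1) L₀) (p : ℕ) : ∃ L, U.CertificateBound K m p L := by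
  classical
  induction p with
  | zero =>
    refine ⟨0, fun X hX => ⟨∅, ⟨?_, fun δ _ => ⟨∅, subset_rfl, by simp, fun a _ f hf => ?_⟩⟩, by simp⟩⟩
    · obtain rfl : X = ∅ := by simpa using hX
      exact subset_rfl
    · obtain rfl : X = ∅ := by simpa using hX
      simp at hf
  | succ p ih =>
    obtain ⟨L, hL⟩ := ih
    -- The exponent is the cardinality bound itself, by the crude N < 2^N.
    refine ⟨2 ^ L + 1 + (2 ^ L + 1) ^ q * 2 ^ L₀, fun X hX => ?_⟩
    rcases X.eq_empty_or_nonempty with rfl | ⟨f, hf⟩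
    · obtain ⟨G, hG, hGc⟩ := hL ∅ (by simp)
      refine ⟨G, hG, hGc.trans (Nat.pow_le_pow_right (by norm_num) ?_)⟩
      have := Nat.lt_two_pow_self (n := L)
      omega
    · obtain ⟨G, hG, hGc⟩ := hL (X.erase f) (by rw [Finset.card_erase_of_mem hf]; omega)
      obtain ⟨H, hH, hHc⟩ := exists_certifies_union hq ({()} : Finset Unit) (fun _ => X.erase f)
        (fun _ => G) {f} (fun _ _ => hG) (s := 2 ^ L₀) (fun X' hX' => h₀ X' (by simpa using hX'))
      rw [Finset.singleton_biUnion, Finset.union_comm, ← Finset.insert_eq,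
        Finset.insert_erase hf] at hH
      rw [Finset.singleton_biUnion, Finset.card_singleton] at hHc
      refine ⟨H, hH, hHc.trans (le_trans ?_ Nat.lt_two_pow_self.le)⟩
      gcongr

theorem iterate {q : ℕ} (hq1 : 1 ≤ q)
    (hq : ∀ Y : Finset U.F, (dominantPatterns K Y).card ≤ (Y.card + 1) ^ q) {ℓ L : ℕ}
    (h : U.CertificateBound K m (m * 2 ^ ℓ) L) (k : ℕ) (hk : 1 ≤ k) :
    ∃ L', L' ≤ k * ((q + 1) * (k * ℓ + L + 1)) ∧ U.CertificateBound K m (m * 2 ^ (k * ℓ)) L' := by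
  have H : ∀ j, 1 ≤ j → j ≤ k → ∃ L', L' ≤ j * ((q + 1) * (k * ℓ + L + 1)) ∧
      U.CertificateBound K m (m * 2 ^ (j * ℓ)) L' := by
    intro j hj
    induction j, hj using Nat.le_induction with
    | base =>
      refine fun _ => ⟨L, ?_, by simpa using h⟩
      nlinarith [Nat.zero_le (q * (k * ℓ + L + 1)), Nat.zero_le (k * ℓ)]
    | succ j hj ih =>
      intro hjk
      obtain ⟨L', hL', hb⟩ := ih (by omega)
      refine ⟨(j * ℓ + L + 1) * q + L' + 1, ?_, ?_⟩
      · have h1 : j * ℓ ≤ k * ℓ := Nat.mul_le_mul_right _ (by omega)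
        have h2 : (j * ℓ + L + 1) * q ≤ (k * ℓ + L + 1) * q := Nat.mul_le_mul_right _ (by omega)
        rw [add_mul j 1, one_mul]
        have h3 : (q + 1) * (k * ℓ + L + 1) = (k * ℓ + L + 1) * q + (k * ℓ + L + 1) := by ring
        omega
      -- The blocks keep the initial size m·2^ℓ and the accumulated bound is used for
      -- recertification. In the other order L' would be multiplied by q each time, giving a cost
      -- exponential in k.
      · have := mul hq1 hq h hb
        rwa [mul_assoc, ← pow_add, show ℓ + j * ℓ = (j + 1) * ℓ by ring] at this
  exact H k hk le_rfl

end CertificateBound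

/-! ### Certificates from restricted coverage -/

theorem exists_finset_cover {t : ℕ} (hcov : ∀ B, U.IsMSet (m + 1) B →
      ∃ C : Set (Set U.A), C.encard ≤ t ∧ (∀ D ∈ C, U.IsMSet m D) ∧ B = ⋃₀ C)
    (x : Fin (m + 1) → U.F) (ρ : Fin (m + 1) → Bool) :
    ∃ C : Finset (List (U.F × Bool)), C.card ≤ t ∧ (∀ ξ ∈ C, ξ.length = m) ∧
      ∀ a, (∀ i, (x i).1 a = ρ i) ↔ ∃ ξ ∈ C, a ∈ U.solutions ξ := by
  classical
  by_cases hne : {a | ∀ i, (x i).1 a = ρ i}.Nonempty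
  · obtain ⟨C, hC, hCm, hCB⟩ := hcov _ ⟨hne, x, ρ, rfl⟩
    have H : ∀ D : Set U.A, ∃ ξ : List (U.F × Bool), D ∈ C → ξ.length = m ∧ U.solutions ξ = D := by
      intro D
      by_cases hD : D ∈ C
      · obtain ⟨ξ, hξ⟩ := (hCm D hD).exists_solutions
        exact ⟨ξ, fun _ => hξ⟩
      · exact ⟨[], fun h => absurd h hD⟩
    choose ξ hξ using H
    have hfin : C.Finite := Set.finite_of_encard_le_coe hC
    refine ⟨hfin.toFinset.image ξ, Finset.card_image_le.trans ?_, ?_, fun a => ?_⟩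
    · rw [hfin.encard_eq_coe_toFinset_card] at hC
      exact_mod_cast hC
    · intro η hη
      obtain ⟨D, hD, rfl⟩ := Finset.mem_image.1 hη
      exact (hξ D (hfin.mem_toFinset.1 hD)).1
    · change a ∈ {a | ∀ i, (x i).1 a = ρ i} ↔ _
      rw [hCB]
      constructor
      · rintro ⟨D, hD, ha⟩
        exact ⟨ξ D, Finset.mem_image_of_mem _ (hfin.mem_toFinset.2 hD), by rwa [(hξ D hD).2]⟩
      · rintro ⟨η, hη, ha⟩
        obtain ⟨D, hD, rfl⟩ := Finset.mem_image.1 hη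
        have hD := hfin.mem_toFinset.1 hD
        exact ⟨D, hD, by rwa [(hξ D hD).2] at ha⟩
  · refine ⟨∅, by simp, by simp, fun a => iff_of_false (fun h => hne ⟨a, h⟩) (by simp)⟩

/-- For each pattern on X the covering (m,U)-sets are fixed, and G collects their attributes. If δ
contradicted every set covering its own pattern, the m+1 equations on X and one contradicting
equation from each of at most t sets would, by dominance, hold at a common point. That point solves
the system on X but lies in no covering set. -/
theorem exists_certificateBound_succ {t : ℕ} (hK : m + 1 + t ≤ K)
    (hcov : ∀ B, U.IsMSet (m + 1) B →
      ∃ C : Set (Set U.A), C.encard ≤ t ∧ (∀ D ∈ C, U.IsMSet m D) ∧ B = ⋃₀ C) :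
    ∃ L, U.CertificateBound K m (m + 1) L := by
  classical
  refine ⟨(m + 1) + 2 ^ (m + 1) * (t * m), fun X hX => ?_⟩
  -- At most m attributes certify themselves.
  rcases Nat.lt_or_eq_of_le hX with hlt | heq
  · refine ⟨X, ⟨subset_rfl, fun δ _ => ⟨X, subset_rfl, by omega, fun a h => h⟩⟩, ?_⟩
    exact le_trans (by omega) Nat.lt_two_pow_self.le
  let e : Fin (m + 1) ≃ X := (X.equivFinOfCardEq heq).symm
  let x : Fin (m + 1) → U.F := fun i => (e i).1
  have hx : Finset.univ.image x = X := by
    ext f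
    simp only [Finset.mem_image, Finset.mem_univ, true_and, x]
    exact ⟨fun ⟨i, hi⟩ => hi ▸ (e i).2, fun hf => ⟨e.symm ⟨f, hf⟩, by simp⟩⟩
  choose C hCt hCm hCB using exists_finset_cover hcov x
  let attrs : List (U.F × Bool) → Finset U.F := fun ξ => (ξ.map Prod.fst).toFinset
  let G : Finset U.F := X ∪ Finset.univ.biUnion fun ρ => (C ρ).biUnion attrs
  have hXG : X ⊆ G := Finset.subset_union_left
  have hattrs : ∀ ρ, ∀ ξ ∈ C ρ, attrs ξ ⊆ G := fun ρ ξ hξ =>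
    ((Finset.subset_biUnion_of_mem attrs hξ).trans (Finset.subset_biUnion_of_mem
      (fun ρ => (C ρ).biUnion attrs) (Finset.mem_univ ρ))).trans Finset.subset_union_right
  have hcard : ∀ ρ, ∀ ξ ∈ C ρ, (attrs ξ).card ≤ m := fun ρ ξ hξ =>
    (List.toFinset_card_le _).trans (by rw [List.length_map, hCm ρ ξ hξ])
  have hmem : ∀ {ξ : List (U.F × Bool)} {p}, p ∈ ξ → p.1 ∈ attrs ξ := fun {ξ p} hp =>
    List.mem_toFinset.2 (List.mem_map_of_mem hp)
  refine ⟨G, ⟨hXG, fun δ hδ => ?_⟩, ?_⟩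
  · let ρ : Fin (m + 1) → Bool := fun i => δ (x i)
    obtain ⟨ξ, hξ, hcons⟩ : ∃ ξ ∈ C ρ, ∀ p ∈ ξ, p.2 = δ p.1 := by
      by_contra! hno
      have H : ∀ ξ, ∃ g : U.F, ξ ∈ C ρ → ∃ x, (g, x) ∈ ξ ∧ x ≠ δ g := by
        intro ξ
        by_cases hξ : ξ ∈ C ρ
        · obtain ⟨p, hp, hne⟩ := hno ξ hξ
          exact ⟨p.1, fun _ => ⟨p.2, hp, hne⟩⟩
        · exact ⟨x 0, fun h => absurd h hξ⟩
      choose w hw using H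
      let W : Finset U.F := X ∪ (C ρ).image w
      have hWG : W ⊆ G := by
        refine Finset.union_subset hXG fun g hg => ?_
        obtain ⟨ξ, hξ, rfl⟩ := Finset.mem_image.1 hg
        obtain ⟨y, hy, -⟩ := hw ξ hξ
        exact hattrs ρ ξ hξ (hmem hy)
      have hWc : W.card ≤ K := by
        refine (Finset.card_union_le _ _).trans (le_trans ?_ hK)
        exact Nat.add_le_add heq.le (Finset.card_image_le.trans (hCt ρ))
      obtain ⟨a, ha⟩ := (hδ.mono hWG).exists_eq hWc
      obtain ⟨ξ, hξ, haξ⟩ := (hCB ρ a).1 fun i => ha _ (Finset.mem_union_left _ (e i).2)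
      obtain ⟨y, hy, hne⟩ := hw ξ hξ
      refine hne ((haξ _ hy).symm.trans ?_)
      exact ha _ (Finset.mem_union_right _ (Finset.mem_image_of_mem _ hξ))
    refine ⟨attrs ξ, hattrs ρ ξ hξ, hcard ρ ξ hξ, fun a ha f hf => ?_⟩
    have := (hCB ρ a).2 ⟨ξ, hξ, fun p hp => by rw [ha _ (hmem hp), hcons p hp]⟩
    rw [← hx] at hf
    obtain ⟨i, -, rfl⟩ := Finset.mem_image.1 hf
    exact this i
  · refine le_trans ?_ Nat.lt_two_pow_self.le
    refine (Finset.card_union_le _ _).trans (Nat.add_le_add heq.le ?_)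
    refine (Finset.card_biUnion_le_card_mul _ _ (t * m) fun ρ _ => ?_).trans (by simp)
    exact (Finset.card_biUnion_le_card_mul _ _ m (hcard ρ)).trans (Nat.mul_le_mul_right _ (hCt ρ))

/-! ### Growth of the size of certifying sets -/

/-- Each stage multiplies the logarithmic size by k and the bound on L by θ. -/
theorem exists_certificateBound_pow {q k : ℕ} (hk : 2 ≤ k) (hq1 : 1 ≤ q)
    (hq : ∀ Y : Finset U.F, (dominantPatterns K Y).card ≤ (Y.card + 1) ^ q) {L₁ : ℕ}
    (h₁ : U.CertificateBound K m (m * 2) L₁) {θ : ℝ} (hθk : (k : ℝ) ≤ θ)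
    (hθ : 2 * (q + 1) * k ≤ θ) :
    ∃ C : ℝ, 0 < C ∧ ∀ i : ℕ, ∃ L : ℕ, (L : ℝ) ≤ C * θ ^ i ∧
      U.CertificateBound K m (m * 2 ^ (k ^ i)) L := by
  have hk0 : (0 : ℝ) < k := by positivity
  have hθ0 : 0 < θ := hk0.trans_le hθk
  refine ⟨2 * k + L₁, by positivity, fun i => ?_⟩
  induction i with
  | zero =>
    refine ⟨L₁, ?_, by simpa using h₁⟩
    rw [pow_zero, mul_one]
    linarith
  | succ i ih =>
    obtain ⟨L, hL, hb⟩ := ih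
    obtain ⟨L', hL', hb'⟩ := hb.iterate hq1 hq k (by omega)
    refine ⟨L', ?_, by rwa [pow_succ' k i]⟩
    have h1 : (L' : ℝ) ≤ k * ((q + 1) * (k * (k : ℝ) ^ i + L + 1)) := by exact_mod_cast hL'
    have h2 : (k : ℝ) ^ i ≤ θ ^ i := pow_le_pow_left₀ hk0.le hθk i
    have h3 : (1 : ℝ) ≤ (k : ℝ) ^ i := one_le_pow₀ (by exact_mod_cast (by omega : 1 ≤ k))
    have h4 : (1 : ℝ) ≤ k := by exact_mod_cast (by omega : 1 ≤ k)
    have h5 : k * (k : ℝ) ^ i + L + 1 ≤ (4 * k + L₁) * θ ^ i := by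
      have : 1 ≤ k * θ ^ i := by nlinarith
      have : k * (k : ℝ) ^ i ≤ k * θ ^ i := mul_le_mul_of_nonneg_left h2 hk0.le
      nlinarith
    have h6 : (0 : ℝ) < θ ^ i := by positivity
    calc (L' : ℝ) ≤ k * ((q + 1) * (k * (k : ℝ) ^ i + L + 1)) := h1
      _ = ((q + 1) * k) * (k * (k : ℝ) ^ i + L + 1) := by ring
      -- The factor 2 in `hθ` halves 4k back to 2k, so the same constant survives every stage.
      _ ≤ (θ / 2) * ((4 * k + L₁) * θ ^ i) := by
          refine mul_le_mul (by linarith) h5 (by positivity) (by positivity)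
      _ ≤ (2 * k + L₁) * θ ^ (i + 1) := by
          rw [pow_succ]
          have : 0 ≤ (L₁ : ℝ) * (θ ^ i * θ) := by positivity
          nlinarith

/-- Once k^ε ≥ 2(q+1), the ratio θ = k^(1+ε) is admissible, and θ^i = (k^i)^(1+ε). Rounding log₂ n
up to an integer, then to a power of k, costs the factors 2^(1+ε) and k^(1+ε). -/
theorem exists_certificateBound_log {q : ℕ} (hm : 1 ≤ m) (hq1 : 1 ≤ q)
    (hq : ∀ Y : Finset U.F, (dominantPatterns K Y).card ≤ (Y.card + 1) ^ q) {L₁ : ℕ}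
    (h₁ : U.CertificateBound K m (m * 2) L₁) {ε : ℝ} (hε : 0 < ε) :
    ∃ C : ℝ, 0 < C ∧ ∀ n : ℕ, 2 ≤ n → ∃ L : ℕ, (L : ℝ) ≤ C * Real.logb 2 n ^ (1 + ε) ∧
      U.CertificateBound K m n L := by
  obtain ⟨k, hk, hk2⟩ : ∃ k : ℕ, (2 * (q + 1) : ℝ) ≤ (k : ℝ) ^ ε ∧ 2 ≤ k := by
    have := (tendsto_rpow_atTop hε).comp tendsto_natCast_atTop_atTop
    exact ((this.eventually_ge_atTop (2 * (q + 1) : ℝ)).and (Filter.eventually_ge_atTop 2)).exists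
  have hk0 : (0 : ℝ) < k := by positivity
  have hk1 : (1 : ℝ) ≤ k := by exact_mod_cast (by omega : 1 ≤ k)
  have hθ : (k : ℝ) ^ (1 + ε) = k * (k : ℝ) ^ ε := by rw [Real.rpow_add hk0, Real.rpow_one]
  have hq0 : (0 : ℝ) ≤ q := by positivity
  obtain ⟨C, hC, H⟩ := exists_certificateBound_pow hk2 hq1 hq h₁ (θ := (k : ℝ) ^ (1 + ε))
    (by rw [hθ]; nlinarith) (by rw [hθ]; nlinarith)
  refine ⟨C * (k : ℝ) ^ (1 + ε) * 2 ^ (1 + ε), by positivity, fun n hn => ?_⟩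
  set ℓ := Nat.clog 2 n with hℓ
  have hℓ1 : ℓ ≠ 0 := (Nat.clog_pos (by norm_num) hn).ne'
  set i := Nat.log k ℓ with hi
  have hilt : ℓ < k ^ (i + 1) := Nat.lt_pow_succ_log_self (by omega) ℓ
  have hile : k ^ i ≤ ℓ := Nat.pow_log_le_self k hℓ1
  obtain ⟨L, hL, hb⟩ := H (i + 1)
  have hn2 : (2 : ℝ) ≤ n := by exact_mod_cast hn
  have hlog1 : 1 ≤ Real.logb 2 n := by
    rw [Real.le_logb_iff_rpow_le (by norm_num) (by linarith)]
    simpa using hn2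
  refine ⟨L, hL.trans ?_, hb.mono ?_⟩
  · have hℓle : (ℓ : ℝ) ≤ 2 * Real.logb 2 n := by
      have h1 : 2 ^ (ℓ - 1) < n := Nat.pow_pred_clog_lt_self (by norm_num) hn
      have h2 : ((ℓ - 1 : ℕ) : ℝ) ≤ Real.logb 2 n := by
        rw [Real.le_logb_iff_rpow_le (by norm_num) (by linarith), Real.rpow_natCast]
        exact_mod_cast h1.le
      rw [Nat.cast_sub (by omega)] at h2
      push_cast at h2
      linarith
    have h3 : ((k : ℝ) ^ (1 + ε)) ^ i ≤ (2 * Real.logb 2 n) ^ (1 + ε) := by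
      rw [← Real.rpow_natCast, ← Real.rpow_mul hk0.le, mul_comm, Real.rpow_mul hk0.le,
        Real.rpow_natCast]
      refine Real.rpow_le_rpow (by positivity) (le_trans ?_ hℓle) (by positivity)
      exact_mod_cast hile
    rw [Real.mul_rpow (by norm_num) (by linarith)] at h3
    rw [pow_succ]
    calc C * (((k : ℝ) ^ (1 + ε)) ^ i * (k : ℝ) ^ (1 + ε))
        ≤ C * ((2 ^ (1 + ε) * Real.logb 2 n ^ (1 + ε)) * (k : ℝ) ^ (1 + ε)) := by gcongr
      _ = _ := by ring
  · calc n ≤ 2 ^ ℓ := Nat.le_pow_clog (by norm_num) n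
      _ ≤ 2 ^ k ^ (i + 1) := Nat.pow_le_pow_right (by norm_num) hilt.le
      _ ≤ m * 2 ^ k ^ (i + 1) := Nat.le_mul_of_pos_left _ hm

/-! ### The decision tree -/

theorem exists_solvableOn_query {B : Set U.A} {v : U.A → ℕ+} {h : ℕ} (g : U.F)
    (H : ∀ x, ∃ s, U.SolvableOn (B ∩ {a | g.1 a = x}) v h s) :
    ∃ s, U.SolvableOn B v (h + 1) s := by
  obtain ⟨s, hs⟩ := H false
  obtain ⟨s', hs'⟩ := H true
  refine ⟨_, SolvableOn.query g (s := s) (s' := s') fun x => ?_⟩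
  cases x
  · simpa using hs
  · simpa using hs'

/-- The tree follows the predicted answers along `l` and leaves at the first wrong one. -/
theorem exists_solvableOn_queries {v : U.A → ℕ+} {h : ℕ} (δ : U.F → Bool) (l : List U.F)
    (B : Set U.A) (hdev : ∀ g ∈ l, ∃ s, U.SolvableOn (B ∩ {a | g.1 a = !δ g}) v h s)
    (hend : ∀ a ∈ B, ∀ b ∈ B, (∀ g ∈ l, g.1 a = δ g) → (∀ g ∈ l, g.1 b = δ g) → v a = v b) :
    ∃ s, U.SolvableOn B v (h + l.length) s := by
  induction l generalizing B with
  | nil =>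
    exact ⟨1, (SolvableOn.leaf fun a ha b hb => hend a ha b hb (by simp) (by simp)).mono subset_rfl
      (Nat.zero_le _) le_rfl⟩
  | cons g l ih =>
    obtain ⟨s, hs⟩ := hdev g List.mem_cons_self
    obtain ⟨s', hs'⟩ := ih (B ∩ {a | g.1 a = δ g})
      (fun g' hg' => by
        obtain ⟨s', hs'⟩ := hdev g' (List.mem_cons_of_mem _ hg')
        exact ⟨s', hs'.mono (Set.inter_subset_inter_left _ Set.inter_subset_left) le_rfl le_rfl⟩)
      (fun a ha b hb h1 h2 => hend a ha.1 b hb.1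
        (by simpa using ⟨ha.2, fun f hf hfl => h1 ⟨f, hf⟩ hfl⟩)
        (by simpa using ⟨hb.2, fun f hf hfl => h2 ⟨f, hf⟩ hfl⟩))
    refine exists_solvableOn_query (h := h + l.length) g fun x => ?_
    by_cases hx : x = δ g
    · exact ⟨s', hx ▸ hs'⟩
    · have : x = !δ g := Bool.eq_not.2 hx
      exact ⟨s, this ▸ hs.mono subset_rfl (Nat.le_add_right _ _) le_rfl⟩

/-- At most m queries either shrink P to a fraction k/(k+1) or end the computation. `B` is a union
of classes of objects that agree on G, and P contains the representatives in `B`; the budget `hcard`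
says that j such rounds are enough. -/
theorem exists_solvableOn_of_certifies {k : ℕ} (hk : 1 ≤ k) (hm : 1 ≤ m) {G X : Finset U.F}
    (hGX : Certifies (k + 1) m G X) {v : U.A → ℕ+}
    (hv : ∀ a b, (∀ f ∈ X, f.1 a = f.1 b) → v a = v b) (R : Finset U.A)
    (hR : ∀ a, ∃ r ∈ R, ∀ g ∈ G, g.1 r = g.1 a) (j : ℕ) (B : Set U.A)
    (hB : ∀ a ∈ B, ∀ r, (∀ g ∈ G, g.1 r = g.1 a) → r ∈ B)
    (P : Finset U.A) (hP : ∀ r ∈ R, r ∈ B → r ∈ P) (hcard : P.card * k ^ j < (k + 1) ^ j) :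
    ∃ s, U.SolvableOn B v (m * j) s := by
  induction j generalizing B P with
  | zero =>
    -- With no rounds left P is empty, hence so is `B`.
    refine ⟨1, SolvableOn.leaf fun a ha => ?_⟩
    obtain ⟨r, hr, hra⟩ := hR a
    have := Finset.card_pos.2 ⟨r, hP r hr (hB a ha r hra)⟩
    simp only [pow_zero, mul_one] at hcard
    omega
  | succ j ih =>
    have hsub : ∀ g ∈ G, ∀ x, (k + 1) * (P.filter fun a => g.1 a = x).card ≤ k * P.card →
        ∃ s, U.SolvableOn (B ∩ {a | g.1 a = x}) v (m * j) s := by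
      intro g hg x hle
      refine ih _ (fun a ha r hr => ⟨hB a ha.1 r hr, (hr g hg).trans ha.2⟩)
        (P.filter fun a => g.1 a = x)
        (fun r hr hrB => Finset.mem_filter.2 ⟨hP r hr hrB.1, hrB.2⟩) ?_
      refine lt_of_mul_lt_mul_left (a := k + 1) ?_ (Nat.zero_le _)
      calc (k + 1) * ((P.filter fun a => g.1 a = x).card * k ^ j)
          = ((k + 1) * (P.filter fun a => g.1 a = x).card) * k ^ j := by ring
        _ ≤ (k * P.card) * k ^ j := Nat.mul_le_mul_right _ hle
        _ = P.card * k ^ (j + 1) := by ring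
        _ < (k + 1) ^ (j + 1) := hcard
        _ = (k + 1) * (k + 1) ^ j := by ring
    have hsplit : ∀ (g : U.F) (x : Bool),
        (P.filter fun a => g.1 a = x).card + (P.filter fun a => g.1 a = !x).card = P.card := by
      intro g x
      rw [← Finset.card_filter_add_card_filter_not (s := P) fun a => g.1 a = x]
      simp only [Bool.eq_not, ne_eq]
    -- The majority answers on P, with ties resolved to 1.
    let δ : U.F → Bool := fun g => decide (P.card ≤ 2 * (P.filter fun a => g.1 a = true).card)
    have hδ : ∀ g : U.F, 2 * (P.filter fun a => g.1 a = !δ g).card ≤ P.card := by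
      intro g
      have hs := hsplit g true
      by_cases h : P.card ≤ 2 * (P.filter fun a => g.1 a = true).card
      · simp only [δ, h, decide_true]
        omega
      · simp only [δ, h, decide_false, Bool.not_false]
        omega
    -- In the balanced case the minority holds at least 1/(k+1) of P, so the majority holds at most
    -- k/(k+1); the minority is at most 1/2 ≤ k/(k+1).
    by_cases hbal : ∃ g ∈ G, P.card ≤ (k + 1) * (P.filter fun a => g.1 a = !δ g).card
    · obtain ⟨g, hg, hle⟩ := hbal
      obtain ⟨s, hs⟩ := exists_solvableOn_query (B := B) (v := v) (h := m * j) g fun x => by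
        refine hsub g hg x ?_
        have h1 := hsplit g (δ g)
        have h2 := hδ g
        by_cases hx : x = δ g
        · rw [hx]
          nlinarith
        · have : x = !δ g := Bool.eq_not.2 hx
          rw [this]
          nlinarith
      exact ⟨s, hs.mono subset_rfl (by rw [mul_add]; omega) le_rfl⟩
    · push Not at hbal
      -- Dominance requires a nonempty set of points.
      rcases P.eq_empty_or_nonempty with hPe | hPne
      · refine ⟨1, (SolvableOn.leaf fun a ha => ?_).mono subset_rfl (Nat.zero_le _) le_rfl⟩
        obtain ⟨r, hr, hra⟩ := hR a
        have := hP r hr (hB a ha r hra)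
        simp [hPe] at this
      · obtain ⟨E, hEG, hEm, hE⟩ := hGX.2 δ ⟨P, hPne, fun g hg => by
          simpa only [Bool.eq_not] using hbal g hg⟩
        obtain ⟨s, hs⟩ := exists_solvableOn_queries (v := v) (h := m * j) δ E.toList B
          (fun g hg => by
            have hgG := hEG (Finset.mem_toList.1 hg)
            refine hsub g hgG _ ((hbal g hgG).le.trans ?_)
            exact Nat.le_mul_of_pos_left _ hk)
          (fun a _ b _ ha hb => hv a b fun f hf => by
            rw [hE a (fun g hg => ha g (Finset.mem_toList.2 hg)) f hf,
              hE b (fun g hg => hb g (Finset.mem_toList.2 hg)) f hf])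
        refine ⟨s, hs.mono subset_rfl ?_ le_rfl⟩
        rw [Finset.length_toList, mul_add, mul_one]
        omega

/-- Bernoulli's inequality for (1 + 1/k)^k: k rounds at least halve the number of representatives.
-/
theorem two_mul_pow_self_le {k : ℕ} (hk : 1 ≤ k) : 2 * k ^ k ≤ (k + 1) ^ k := by
  have hk0 : (0 : ℝ) < k := by exact_mod_cast hk
  have h := one_add_mul_le_pow (a := (1 / k : ℝ)) (by linarith [one_div_pos.2 hk0]) k
  rw [mul_one_div_cancel hk0.ne', one_add_one_eq_two, one_add_div hk0.ne', div_pow,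
    le_div_iff₀ (by positivity)] at h
  exact_mod_cast h

theorem CertificateBound.hd_le {k d n L : ℕ} (hk : 1 ≤ k) (hm : 1 ≤ m) (hd : U.iDim ≤ d)
    (h : U.CertificateBound (k + 1) m n L) :
    U.hd n ≤ ((m * (k * ((L + 1) * d + 1)) : ℕ) : ℕ∞) := by
  classical
  refine iSup₂_le fun z hz => ?_
  have hXc : (Finset.univ.image z.f).card ≤ n :=
    Finset.card_image_le.trans (by simpa using hz)
  obtain ⟨G, hG, hGc⟩ := h _ hXc
  let f : G → U.F := Subtype.val
  have hfin := Set.toFinite (Set.range (tuple f))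
  have hrep : ∀ x : G → Bool, ∃ a : U.A, x ∈ Set.range (tuple f) → tuple f a = x := by
    intro x
    by_cases hx : x ∈ Set.range (tuple f)
    · obtain ⟨a, ha⟩ := hx
      exact ⟨a, fun _ => ha⟩
    · have := U.infinite_A
      exact ⟨Classical.arbitrary _, fun h => absurd h hx⟩
  choose r hr using hrep
  let R := hfin.toFinset.image r
  have hRc : R.card < 2 ^ ((L + 1) * d + 1) := by
    have h1 : R.card ≤ (Set.range (tuple f)).ncard := by
      rw [Set.ncard_eq_toFinset_card _ hfin]
      exact Finset.card_image_le
    have h2 := ncard_range_tuple_le hd f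
    rw [Fintype.card_coe] at h2
    have h3 : G.card + 1 ≤ 2 ^ (L + 1) := by
      have : 1 ≤ 2 ^ L := Nat.one_le_two_pow
      rw [pow_succ]
      omega
    have h4 : (G.card + 1) ^ d ≤ 2 ^ ((L + 1) * d) := by
      rw [pow_mul]
      exact Nat.pow_le_pow_left h3 d
    have h5 : 0 < 2 ^ ((L + 1) * d) := by positivity
    rw [pow_succ]
    omega
  obtain ⟨s, hs⟩ := exists_solvableOn_of_certifies hk hm hG (v := z.value)
    (fun a b hab => by
      simp only [Problem.value]
      congr 1
      funext i
      exact hab _ (Finset.mem_image_of_mem _ (Finset.mem_univ i)))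
    R (fun a => ⟨r (tuple f a), Finset.mem_image_of_mem _ (hfin.mem_toFinset.2 ⟨a, rfl⟩),
      fun g hg => congrFun (hr (tuple f a) ⟨a, rfl⟩) ⟨g, hg⟩⟩)
    -- There are fewer than 2^((L+1)d+1) representatives, and each halving takes k rounds.
    (k * ((L + 1) * d + 1)) Set.univ (fun _ _ _ _ => trivial) R (fun _ h _ => h) (by
      rw [pow_mul, pow_mul]
      refine lt_of_lt_of_le (Nat.mul_lt_mul_of_pos_right hRc (by positivity)) ?_
      rw [← mul_pow]
      exact Nat.pow_le_pow_left (two_mul_pow_self_le hk) _)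
  exact hs.hd_le

theorem RestrictedCoverage.exists_hd_le (h : U.RestrictedCoverage) {d : ℕ} (hd : U.iDim ≤ d)
    {ε : ℝ} (hε : 0 < ε) :
    ∃ c : ℝ, 0 < c ∧ ∀ n : ℕ, 2 ≤ n → ∃ k : ℕ, U.hd n ≤ k ∧
      (k : ℝ) ≤ c * Real.logb 2 n ^ (1 + ε) := by
  obtain ⟨m, t, hm, ht, hcov⟩ := h
  -- Then K = k+1 is at least 4, for counting dominant patterns, and at least m+1+t, for the base
  -- certificates.
  set k := m + t + 3 with hk
  obtain ⟨q, hq1, hq⟩ := exists_card_dominantPatterns_le (K := k + 1) (by omega) hd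
  obtain ⟨L₀, h₀⟩ := exists_certificateBound_succ (K := k + 1) (by omega) hcov
  obtain ⟨L₁, h₁⟩ := CertificateBound.exists_of_succ hq h₀ (m * 2)
  obtain ⟨C, hC, H⟩ := exists_certificateBound_log hm hq1 hq h₁ hε
  refine ⟨m * (k * ((C + 1) * d + 1)), by positivity, fun n hn => ?_⟩
  obtain ⟨L, hL, hb⟩ := H n hn
  refine ⟨_, hb.hd_le (by omega) hm hd, ?_⟩
  have hn2 : (2 : ℝ) ≤ n := by exact_mod_cast hn
  have hlog1 : 1 ≤ Real.logb 2 n := by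
    rw [Real.le_logb_iff_rpow_le (by norm_num) (by linarith)]
    simpa using hn2
  have hlog2 : 1 ≤ Real.logb 2 n ^ (1 + ε) := Real.one_le_rpow hlog1 (by positivity)
  set y := Real.logb 2 n ^ (1 + ε)
  push_cast
  calc (m : ℝ) * (k * ((L + 1) * d + 1)) ≤ m * (k * ((C * y + y) * d + y)) := by gcongr
    _ = m * (k * ((C + 1) * d + 1)) * y := by ring

/-! ### Types of behavior -/

theorem describes_log (hI : U.iDim ≠ ⊤) (h : U.RestrictedCoverage) :
    DetDepthType.LOG.Describes U.hd := by
  intro ε hε _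
  obtain ⟨d, hd⟩ := ENat.ne_top_iff_exists.1 hI
  obtain ⟨c, hc, H⟩ := h.exists_hd_le hd.ge hε
  refine ⟨c, hc, fun n hn => ?_⟩
  obtain ⟨k, hk⟩ := ENat.ne_top_iff_exists.1 (ne_top_of_le_ne_top (ENat.natCast_ne_top n)
    (U.hd_le n))
  have hn1 : (0 : ℝ) < (n + 1 : ℕ) := by positivity
  refine ⟨k, hk.symm, ?_, ?_⟩
  · obtain ⟨f, hf⟩ := U.exists_lt_ncard_range_tuple n
    -- The depth is at least ⌈log₂(n+1)⌉, because some n attributes realize n+1 tuples.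
    have h1 : 2 ^ (Nat.clog 2 (n + 1) - 1) < n + 1 :=
      Nat.pow_pred_clog_lt_self (by norm_num) (by omega)
    have h2 : 0 < Nat.clog 2 (n + 1) := Nat.clog_pos (by norm_num) (by omega)
    have h3 : 2 ^ Nat.clog 2 (n + 1) = 2 * 2 ^ (Nat.clog 2 (n + 1) - 1) := by
      rw [← pow_succ', Nat.sub_add_cancel h2]
    have h4 := le_hd hn f (k := Nat.clog 2 (n + 1)) (by omega)
    rw [← hk] at h4
    have h5 : Nat.clog 2 (n + 1) ≤ k := by exact_mod_cast h4
    have h6 : n + 1 ≤ 2 ^ k :=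
      (Nat.le_pow_clog (by norm_num) _).trans (Nat.pow_le_pow_right (by norm_num) h5)
    rw [Real.logb_le_iff_le_rpow (by norm_num) (by exact_mod_cast hn1), Real.rpow_natCast]
    exact_mod_cast h6
  -- At n = 1 the logarithm vanishes and only the summand 1 of the bound remains.
  · rcases hn.eq_or_lt with rfl | hn2
    · have : (k : ℕ∞) ≤ (1 : ℕ) := hk ▸ U.hd_le 1
      have : k ≤ 1 := by exact_mod_cast this
      have hk1 : (k : ℝ) ≤ 1 := by exact_mod_cast this
      simp only [Nat.cast_one, Real.logb_one]
      rw [Real.zero_rpow (by positivity)]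
      linarith
    · obtain ⟨k', h1, h2⟩ := H n hn2
      rw [← hk] at h1
      have h3 : k ≤ k' := by exact_mod_cast h1
      have h4 : (k : ℝ) ≤ k' := by exact_mod_cast h3
      linarith

theorem describes_pol (hI : U.iDim ≠ ⊤) :
    SizeType.POL.Describes U.iDim U.Ld ∧ SizeType.POL.Describes U.iDim U.La := by
  obtain ⟨d, hd⟩ := ENat.ne_top_iff_exists.1 hI
  refine ⟨⟨d, hd.symm, fun n hn => ⟨?_, ?_⟩⟩, ⟨d, hd.symm, fun n hn => ⟨?_, ?_⟩⟩⟩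
  · exact (U.linear_le_La n hn).trans (La_le_Ld n)
  · exact Ld_le_of_iDim hd.ge n hn
  · exact U.linear_le_La n hn
  · exact (La_le_Ld n).trans (Ld_le_of_iDim hd.ge n hn)

end InfoSystem

/-! ### Mutual exclusion of the types of behavior -/

theorem DetDepthType.Describes.not_lin_of_log {h : ℕ → ℕ∞} (h1 : LOG.Describes h)
    (h2 : LIN.Describes h) : False := by
  -- At n = 2^j both types would give 2^j ≤ c·j^(3/2) + 1 ≤ (c+1)·j², which fails for large j.
  obtain ⟨c, hc, H⟩ := h1 (1 / 2) (by norm_num) (by norm_num)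
  obtain ⟨C, hC⟩ := exists_nat_ge (c + 1)
  obtain ⟨j, hj, hj1⟩ := ((InfoSystem.eventually_pow_lt_pow C 2 (one_lt_two (α := ℝ))).and
    (Filter.eventually_ge_atTop 1)).exists
  obtain ⟨k, hk, -, hle⟩ := H (2 ^ j) Nat.one_le_two_pow
  rw [h2 _ Nat.one_le_two_pow] at hk
  have hk' : 2 ^ j = k := by exact_mod_cast hk
  have hj1' : (1 : ℝ) ≤ j := by exact_mod_cast hj1
  rw [← hk'] at hle
  push_cast at hle hj
  rw [Real.logb_pow, Real.logb_self_eq_one (by norm_num), mul_one] at hle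
  have h3 : (j : ℝ) ^ (1 + 1 / 2 : ℝ) ≤ (j : ℝ) ^ 2 := by
    rw [← Real.rpow_natCast]
    exact Real.rpow_le_rpow_of_exponent_le hj1' (by norm_num)
  have h4 : c * (j : ℝ) ^ (1 + 1 / 2 : ℝ) ≤ c * (j : ℝ) ^ 2 := mul_le_mul_of_nonneg_left h3 hc.le
  have h5 : (1 : ℝ) ≤ (j : ℝ) ^ 2 := one_le_pow₀ hj1'
  have h6 : (c + 1) * (j : ℝ) ^ 2 ≤ (C : ℝ) ^ 2 * (j : ℝ) ^ 2 := by
    refine mul_le_mul_of_nonneg_right ?_ (by positivity)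
    nlinarith
  rw [mul_pow] at hj
  linarith

theorem DetDepthType.Describes.unique {h : ℕ → ℕ∞} {x y : DetDepthType} (hx : x.Describes h)
    (hy : y.Describes h) : x = y := by
  cases x <;> cases y <;> try rfl
  · exact (hx.not_lin_of_log hy).elim
  · exact (hy.not_lin_of_log hx).elim

theorem NondetDepthType.Describes.not_lin_of_con {h : ℕ → ℕ∞} (h1 : CON.Describes h)
    (h2 : LIN.Describes h) : False := by
  obtain ⟨c, -, H⟩ := h1
  have := H (c + 1) (by omega)
  rw [h2 _ (by omega)] at this
  have : c + 1 ≤ c := by exact_mod_cast this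
  omega

theorem NondetDepthType.Describes.unique {h : ℕ → ℕ∞} {x y : NondetDepthType}
    (hx : x.Describes h) (hy : y.Describes h) : x = y := by
  cases x <;> cases y <;> try rfl
  · exact (hx.not_lin_of_con hy).elim
  · exact (hy.not_lin_of_con hx).elim

theorem SizeType.Describes.not_exp_of_pol {I : ℕ∞} {L : ℕ → ℕ∞} (h1 : POL.Describes I L)
    (h2 : EXP.Describes I L) : False := by
  obtain ⟨d, -, H⟩ := h1
  obtain ⟨n, hn, hn1⟩ := ((InfoSystem.eventually_pow_lt_pow 4 d (one_lt_two (α := ℝ))).and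
    (Filter.eventually_ge_atTop 1)).exists
  have hle := (H n hn1).2
  rw [h2 n hn1] at hle
  have hle' : 2 ^ (n + 1) ≤ 2 * (4 * n) ^ d := by exact_mod_cast hle
  have hlt : (4 * n) ^ d < 2 ^ n := by exact_mod_cast hn
  rw [pow_succ] at hle'
  omega

theorem SizeType.Describes.unique {I : ℕ∞} {L : ℕ → ℕ∞} {x y : SizeType}
    (hx : x.Describes I L) (hy : y.Describes I L) : x = y := by
  cases x <;> cases y <;> try rfl
  · exact (hx.not_exp_of_pol hy).elim
  · exact (hy.not_exp_of_pol hx).elim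

namespace InfoSystem

variable {U : InfoSystem.{u}}

theorem HasType.unique {σ τ : SystemType} (hσ : U.HasType σ) (hτ : U.HasType τ) : σ = τ := by
  cases σ
  cases τ
  obtain ⟨h1, h2, h3, h4⟩ := hσ
  obtain ⟨k1, k2, k3, k4⟩ := hτ
  rw [SystemType.mk.injEq]
  exact ⟨h1.unique k1, h2.unique k2, h3.unique k3, h4.unique k4⟩

theorem hasType_zero (hI : U.iDim ≠ ⊤) (h : U.RestrictedCoverage) : U.HasType (typeTable 0) :=
  ⟨describes_log hI h, h.coverage.exists_ha_le, (describes_pol hI).1, (describes_pol hI).2⟩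

theorem hasType_one (hI : U.iDim ≠ ⊤) (h : U.Coverage) (h' : ¬ U.RestrictedCoverage) :
    U.HasType (typeTable 1) :=
  ⟨hd_eq_of_not_restrictedCoverage h', h.exists_ha_le, (describes_pol hI).1, (describes_pol hI).2⟩

theorem hasType_two (hI : U.iDim ≠ ⊤) (h : ¬ U.Coverage) : U.HasType (typeTable 2) :=
  ⟨hd_eq_of_not_restrictedCoverage fun h' => h h'.coverage, ha_eq_of_not_coverage h,
    (describes_pol hI).1, (describes_pol hI).2⟩

theorem hasType_three (hI : U.iDim = ⊤) (h : U.Coverage) : U.HasType (typeTable 3) :=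
  ⟨hd_eq_of_iDim_eq_top hI, h.exists_ha_le, Ld_eq_of_iDim_eq_top hI, La_eq_of_iDim_eq_top hI⟩

theorem hasType_four (hI : U.iDim = ⊤) (h : ¬ U.Coverage) : U.HasType (typeTable 4) :=
  ⟨hd_eq_of_iDim_eq_top hI, ha_eq_of_not_coverage h, Ld_eq_of_iDim_eq_top hI,
    La_eq_of_iDim_eq_top hI⟩

/-- The table row of a system is determined by `I(U)` and the two conditions of coverage. -/
theorem exists_row (U : InfoSystem.{u}) : ∃ i : Fin 5,
    (∀ τ : SystemType, U.HasType τ ↔ τ = typeTable i) ∧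
    ((typeTable i).hd = .LOG ↔ U.iDim ≠ ⊤ ∧ U.RestrictedCoverage) ∧
    ((typeTable i).ha = .CON ↔ U.Coverage) ∧
    ((typeTable i).Ld = .POL ↔ U.iDim ≠ ⊤) := by
  have huniq : ∀ {i : Fin 5}, U.HasType (typeTable i) →
      ∀ τ : SystemType, U.HasType τ ↔ τ = typeTable i :=
    fun h τ => ⟨fun hτ => hτ.unique h, fun hτ => hτ ▸ h⟩
  by_cases hI : U.iDim = ⊤
  · by_cases hC : U.Coverage
    · exact ⟨3, huniq (hasType_three hI hC), by simp [typeTable, hI, hC]⟩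
    · exact ⟨4, huniq (hasType_four hI hC), by simp [typeTable, hI, hC]⟩
  · by_cases hC : U.Coverage
    · by_cases hR : U.RestrictedCoverage
      · exact ⟨0, huniq (hasType_zero hI hR), by simp [typeTable, hI, hC, hR]⟩
      · exact ⟨1, huniq (hasType_one hI hC hR), by simp [typeTable, hI, hC, hR]⟩
    · have hR : ¬ U.RestrictedCoverage := fun h => hC h.coverage
      exact ⟨2, huniq (hasType_two hI hC), by simp [typeTable, hI, hC, hR]⟩

/-! ### The five examples -/

theorem Independent.exists_eq {S : Finset (U.A → Bool)} (h : U.Independent S) {f g : U.A → Bool}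
    (hf : f ∈ S) (hg : g ∈ S) (hfg : f ≠ g) (x y : Bool) : ∃ a, f a = x ∧ g a = y := by
  classical
  obtain ⟨a, ha⟩ := h fun k => if k = f then x else y
  refine ⟨a, by simpa using ha f hf, ?_⟩
  simpa [hfg.symm] using ha g hg

theorem iDim_ne_top {d : ℕ} (h : ∀ S : Finset (U.A → Bool), (S : Set (U.A → Bool)) ⊆ U.F →
    U.Independent S → S.card ≤ d) : U.iDim ≠ ⊤ := by
  refine ne_top_of_le_ne_top (ENat.natCast_ne_top d) (iSup₂_le fun S hS => ?_)
  exact_mod_cast h S hS.1 hS.2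

theorem iDim_eq_top (h : ∀ n : ℕ, ∃ f : Fin n → U.F, Function.Surjective (tuple f)) :
    U.iDim = ⊤ := by
  classical
  refine ENat.eq_top_iff_forall_ge.2 fun n => ?_
  obtain ⟨f, hf⟩ := h n
  have hinj : Function.Injective fun i => (f i).1 := by
    intro i j hij
    obtain ⟨a, ha⟩ := hf fun k => decide (k = i)
    have h1 : (f i).1 a = decide (i = i) := congrFun ha i
    have h2 : (f j).1 a = decide (j = i) := congrFun ha j
    have h3 : (f i).1 a = (f j).1 a := congrFun hij a
    rw [h1, h2] at h3
    simpa [eq_comm] using h3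
  refine le_iSup₂_of_le (Finset.univ.image fun i => (f i).1) ⟨?_, fun δ => ?_⟩ ?_
  · intro g hg
    simp only [Finset.coe_image, Set.mem_image] at hg
    obtain ⟨i, -, rfl⟩ := hg
    exact (f i).2
  · obtain ⟨a, ha⟩ := hf fun i => δ (f i).1
    refine ⟨a, fun g hg => ?_⟩
    obtain ⟨i, -, rfl⟩ := Finset.mem_image.1 hg
    exact congrFun ha i
  · rw [Finset.card_image_of_injective _ hinj]
    simp

end InfoSystem

open InfoSystem

theorem not_lAttr_pattern {i j : ℕ+} (h : lAttr i ≠ lAttr j) :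
    ∃ x y, ¬ ∃ a, lAttr i a = x ∧ lAttr j a = y := by
  rcases lt_trichotomy i j with hij | rfl | hij
  · refine ⟨false, true, fun ⟨a, h1, h2⟩ => ?_⟩
    simp only [lAttr, decide_eq_false_iff_not, decide_eq_true_eq] at h1 h2
    exact h1 (hij.trans h2)
  · exact absurd rfl h
  · refine ⟨true, false, fun ⟨a, h1, h2⟩ => ?_⟩
    simp only [lAttr, decide_eq_false_iff_not, decide_eq_true_eq] at h1 h2
    exact h2 (hij.trans h1)

theorem not_pAttr_pattern {i j : ℕ+} (h : pAttr i ≠ pAttr j) :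
    ¬ ∃ a, pAttr i a = true ∧ pAttr j a = true := by
  rintro ⟨a, h1, h2⟩
  simp only [pAttr, decide_eq_true_eq] at h1 h2
  exact h (by rw [← h1, ← h2])

/-! ### Finite independence dimension of the first three examples -/

theorem iDim_U₁_ne_top : U₁.iDim ≠ ⊤ := by
  refine iDim_ne_top (d := 1) fun S hS hind => Finset.card_le_one.2 fun f hf g hg => ?_
  by_contra hfg
  obtain ⟨i, rfl⟩ := hS hf
  obtain ⟨j, rfl⟩ := hS hg
  obtain ⟨x, y, h⟩ := not_lAttr_pattern hfg
  exact h (hind.exists_eq hf hg hfg x y)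

theorem iDim_U₃_ne_top : U₃.iDim ≠ ⊤ := by
  refine iDim_ne_top (d := 1) fun S hS hind => Finset.card_le_one.2 fun f hf g hg => ?_
  by_contra hfg
  obtain ⟨i, rfl⟩ := hS hf
  obtain ⟨j, rfl⟩ := hS hg
  exact not_pAttr_pattern hfg (hind.exists_eq hf hg hfg true true)

theorem iDim_U₂_ne_top : U₂.iDim ≠ ⊤ := by
  classical
  refine iDim_ne_top (d := 2) fun S hS hind => ?_
  rw [← Finset.card_filter_add_card_filter_not (s := S) (· ∈ Set.range pAttr)]
  refine Nat.add_le_add (Finset.card_le_one.2 fun f hf g hg => ?_)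
    (Finset.card_le_one.2 fun f hf g hg => ?_)
  · rw [Finset.mem_filter] at hf hg
    by_contra hfg
    have h := hind.exists_eq hf.1 hg.1 hfg true true
    obtain ⟨i, rfl⟩ := hf.2
    obtain ⟨j, rfl⟩ := hg.2
    exact not_pAttr_pattern hfg h
  · rw [Finset.mem_filter] at hf hg
    by_contra hfg
    have h := hind.exists_eq hf.1 hg.1 hfg
    obtain ⟨i, rfl⟩ := (hS hf.1).resolve_left hf.2
    obtain ⟨j, rfl⟩ := (hS hg.1).resolve_left hg.2
    obtain ⟨x, y, h'⟩ := not_lAttr_pattern hfg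
    exact h' (h x y)

/-! ### Restricted coverage for thresholds -/

theorem lAttr_merge (i j : ℕ+) (x : Bool) :
    ∃ k, ∀ a, (lAttr i a = x ∧ lAttr j a = x) ↔ lAttr k a = x := by
  cases x
  · exact ⟨min i j, fun a => by simp [lAttr]⟩
  · exact ⟨max i j, fun a => by simp [lAttr]⟩

/-- Of three equations two have the same right side, and these merge into a single threshold. -/
theorem lAttr_merge_three (i : Fin 3 → ℕ+) (δ : Fin 3 → Bool) :
    ∃ j k x y, ∀ a, (∀ r, lAttr (i r) a = δ r) ↔ lAttr j a = x ∧ lAttr k a = y := by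
  have h : δ 0 = δ 1 ∨ δ 0 = δ 2 ∨ δ 1 = δ 2 := by
    cases δ 0 <;> cases δ 1 <;> cases δ 2 <;> simp
  simp only [Fin.forall_fin_succ, Fin.succ_zero_eq_one, Fin.succ_one_eq_two, IsEmpty.forall_iff,
    and_true]
  rcases h with h | h | h
  · obtain ⟨j, hj⟩ := lAttr_merge (i 0) (i 1) (δ 1)
    exact ⟨j, i 2, δ 1, δ 2, fun a => by rw [← hj, h, and_assoc]⟩
  · obtain ⟨j, hj⟩ := lAttr_merge (i 0) (i 2) (δ 2)
    exact ⟨j, i 1, δ 2, δ 1, fun a => by rw [← hj, h]; tauto⟩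
  · obtain ⟨j, hj⟩ := lAttr_merge (i 1) (i 2) (δ 2)
    exact ⟨i 0, j, δ 0, δ 2, fun a => by rw [← hj, h]⟩

theorem restrictedCoverage_U₁ : U₁.RestrictedCoverage := by
  refine ⟨2, 1, by norm_num, le_rfl, fun B hB => ⟨{B}, by simp, ?_, by simp⟩⟩
  obtain ⟨hne, f, δ, rfl⟩ := hB
  choose i hi using fun r => (f r).2
  obtain ⟨j, k, x, y, h⟩ := lAttr_merge_three i δ
  rintro _ rfl
  refine ⟨hne, ![⟨lAttr j, j, rfl⟩, ⟨lAttr k, k, rfl⟩], ![x, y], Set.ext fun a => ?_⟩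
  simp only [Set.mem_ofPred_eq, ← hi]
  rw [h a]
  simp [Fin.forall_fin_two]

/-! ### Coverage without restricted coverage -/

theorem finite_or_finite_compl_of_mem_U₂ {f : ℕ+ → Bool} (hf : f ∈ U₂.F) (x : Bool) :
    ∃ N : ℕ+, (∀ a, f a = x → a ≤ N) ∨ ∀ a, N < a → f a = x := by
  rcases hf with ⟨i, rfl⟩ | ⟨i, rfl⟩
  · refine ⟨i, ?_⟩
    cases x
    · exact .inr fun a ha => by simpa [pAttr] using ha.ne'
    · exact .inl fun a ha => by
        simp only [pAttr, decide_eq_true_eq] at ha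
        exact ha.le
  · refine ⟨2 ^ (i : ℕ), ?_⟩
    cases x
    · exact .inl fun a ha => by simpa [lAttr] using ha
    · exact .inr fun a ha => by simpa [lAttr] using ha

theorem exists_bound_of_isMSet_U₂ {n : ℕ} {B : Set ℕ+} (hB : U₂.IsMSet n B) :
    ∃ N : ℕ+, (∀ a ∈ B, a ≤ N) ∨ ∀ a, N < a → a ∈ B := by
  induction n generalizing B with
  | zero =>
    obtain ⟨-, f, δ, rfl⟩ := hB
    exact ⟨1, .inr fun a _ i => i.elim0⟩
  | succ n ih =>
    obtain ⟨B', g, x, hB', rfl⟩ := hB.exists_inter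
    obtain ⟨N, hN⟩ := ih hB'
    obtain ⟨M, hM⟩ := finite_or_finite_compl_of_mem_U₂ g.2 x
    rcases hN with hN | hN
    · exact ⟨N, .inl fun a ha => hN a ha.1⟩
    rcases hM with hM | hM
    · exact ⟨M, .inl fun a ha => hM a ha.2⟩
    · exact ⟨max N M, .inr fun a ha =>
        ⟨hN a (lt_of_le_of_lt (le_max_left _ _) ha), hM a (lt_of_le_of_lt (le_max_right _ _) ha)⟩⟩

theorem PNat.lt_two_pow_self (N : ℕ+) : N < 2 ^ (N : ℕ) := by
  rw [← PNat.coe_lt_coe, PNat.pow_coe]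
  exact Nat.lt_two_pow_self

theorem exists_finite_cover_of_bound (Q : Set ℕ+ → Prop) (hsing : ∀ a, Q {a})
    (htail : ∀ N : ℕ+, Q {a | 2 ^ (N : ℕ) < a}) (B : Set ℕ+)
    (hB : ∃ N : ℕ+, (∀ a ∈ B, a ≤ N) ∨ ∀ a, N < a → a ∈ B) :
    ∃ C : Set (Set ℕ+), C.Finite ∧ (∀ D ∈ C, Q D) ∧ B = ⋃₀ C := by
  have hfin : ∀ N : ℕ+, {a : ℕ+ | a ≤ N}.Finite := fun N => Set.finite_Iic N
  obtain ⟨N, hN | hN⟩ := hB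
  · refine ⟨(fun a : ℕ+ => ({a} : Set ℕ+)) '' B, ((hfin N).subset hN).image _, ?_, ?_⟩
    · rintro _ ⟨a, -, rfl⟩
      exact hsing a
    · rw [Set.sUnion_image]
      exact (Set.biUnion_of_singleton B).symm
  -- The threshold is 2^N because only powers of two are available; as N < 2^N this tail still lies
  -- in B, and finitely many points remain.
  · let T : Set ℕ+ := {a | 2 ^ (N : ℕ) < a}
    refine ⟨insert T ((fun a : ℕ+ => ({a} : Set ℕ+)) '' {a ∈ B | a ≤ 2 ^ (N : ℕ)}),
      (((hfin _).subset fun a ha => ha.2).image _).insert T, ?_, ?_⟩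
    · rintro _ (rfl | ⟨a, -, rfl⟩)
      · exact htail N
      · exact hsing a
    · rw [Set.sUnion_insert, Set.sUnion_image, Set.biUnion_of_singleton]
      ext a
      constructor
      · intro ha
        rcases lt_or_ge (2 ^ (N : ℕ)) a with h | h
        · exact .inl h
        · exact .inr ⟨ha, h⟩
      · rintro (h | h)
        · exact hN a ((PNat.lt_two_pow_self N).trans h)
        · exact h.1

theorem coverage_U₂ : U₂.Coverage := by
  refine ⟨1, le_rfl, fun B hB => exists_finite_cover_of_bound (U₂.IsMSet 1) (fun a => ?_)
    (fun N => ?_) B (exists_bound_of_isMSet_U₂ hB)⟩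
  · refine ⟨⟨a, rfl⟩, fun _ => ⟨pAttr a, .inl ⟨a, rfl⟩⟩, fun _ => true, Set.ext fun b => ?_⟩
    change b = a ↔ ∀ _ : Fin 1, pAttr a b = true
    simp [pAttr]
  · refine ⟨⟨2 ^ (N : ℕ) + 1, PNat.lt_add_right _ _⟩,
      fun _ => ⟨lAttr (2 ^ (N : ℕ)), .inr ⟨N, rfl⟩⟩, fun _ => true, Set.ext fun b => ?_⟩
    change 2 ^ (N : ℕ) < b ↔ ∀ _ : Fin 1, lAttr (2 ^ (N : ℕ)) b = true
    simp [lAttr]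

/-- The interval `(2^i, 2^(i+1)]` without its `k` smallest elements. -/
def punctured (i : ℕ+) (k : ℕ) : Set ℕ+ :=
  {a | 2 ^ (i : ℕ) < (a : ℕ) ∧ (a : ℕ) ≤ 2 * 2 ^ (i : ℕ) ∧
    ∀ r : Fin k, (a : ℕ) ≠ 2 ^ (i : ℕ) + r + 1}

theorem isMSet_U₂_iff {n : ℕ} {D : Set ℕ+} : U₂.IsMSet n D ↔ D.Nonempty ∧
    ∃ (f : Fin n → ℕ+ → Bool) (δ : Fin n → Bool),
      (∀ j, (∃ c, pAttr c = f j) ∨ ∃ e : ℕ+, lAttr (2 ^ (e : ℕ)) = f j) ∧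
        D = {a | ∀ j, f j a = δ j} := by
  constructor
  · rintro ⟨hne, f, δ, rfl⟩
    exact ⟨hne, fun j => (f j).1, δ, fun j => (f j).2, rfl⟩
  · rintro ⟨hne, f, δ, hf, rfl⟩
    exact ⟨hne, fun j => ⟨f j, hf j⟩, δ, rfl⟩

theorem lAttr_two_pow_eq_true {e : ℕ} {a : ℕ+} : lAttr (2 ^ e) a = true ↔ 2 ^ e < (a : ℕ) := by
  rw [lAttr, decide_eq_true_eq, ← PNat.coe_lt_coe, PNat.pow_coe]
  rfl

theorem lAttr_two_pow_eq_false {e : ℕ} {a : ℕ+} : lAttr (2 ^ e) a = false ↔ (a : ℕ) ≤ 2 ^ e := by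
  rw [← Bool.not_eq_true, lAttr_two_pow_eq_true, not_lt]

theorem isMSet_punctured (i : ℕ+) (k : ℕ) (h : (punctured i k).Nonempty) :
    U₂.IsMSet (k + 2) (punctured i k) := by
  refine isMSet_U₂_iff.2 ⟨h, Fin.cons (lAttr (2 ^ (i : ℕ)))
    (Fin.cons (lAttr (2 ^ ((i + 1 : ℕ+) : ℕ)))
      fun r : Fin k => pAttr (2 ^ (i : ℕ) + (r : ℕ)).succPNat),
    Fin.cons true (Fin.cons false fun _ => false), ?_, Set.ext fun a => ?_⟩
  · refine Fin.cases (.inr ⟨i, rfl⟩) (Fin.cases (.inr ⟨i + 1, rfl⟩) fun r => .inl ⟨_, rfl⟩)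
  · rw [Set.mem_ofPred_eq, Fin.forall_fin_succ, Fin.forall_fin_succ]
    simp only [Fin.cons_zero, Fin.cons_succ, lAttr_two_pow_eq_true, lAttr_two_pow_eq_false,
      punctured, Set.mem_ofPred_eq, PNat.add_coe, PNat.one_coe, pAttr,
      decide_eq_false_iff_not, ← PNat.coe_inj, Nat.succPNat_coe, Nat.succ_eq_add_one]
    rw [pow_succ']

/-- Points outside of `punctured i k` such that an equation `p = 0`, or an equation with an
attribute `l` that is satisfied at some point of `punctured i k`, fails at most at one of them. -/
def outerPoint (i : ℕ+) (k : ℕ) (s : Fin (k + 2)) : ℕ+ :=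
  (if (s : ℕ) = k + 1 then 2 * 2 ^ (i : ℕ) else 2 ^ (i : ℕ) + (s : ℕ) - 1).succPNat

theorem coe_outerPoint (i : ℕ+) (k : ℕ) (s : Fin (k + 2)) :
    (outerPoint i k s : ℕ) =
      if (s : ℕ) = k + 1 then 2 * 2 ^ (i : ℕ) + 1 else 2 ^ (i : ℕ) + (s : ℕ) := by
  rw [outerPoint, Nat.succPNat_coe]
  have : 0 < 2 ^ (i : ℕ) := by positivity
  split_ifs <;> omega

theorem outerPoint_notMem (i : ℕ+) (k : ℕ) (s : Fin (k + 2)) :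
    outerPoint i k s ∉ punctured i k := by
  rintro ⟨h1, h2, h3⟩
  rw [coe_outerPoint] at h1 h2
  split_ifs at h1 h2 with hs
  · omega
  · refine h3 ⟨s - 1, by omega⟩ ?_
    rw [coe_outerPoint, if_neg hs]
    simp only
    omega

/-- An equation p = 1 leaves one point. Otherwise each of the k+1 equations, being satisfiable in
the punctured interval, excludes at most one of the k+2 outer points, so some outer point would
remain in D. The bound on k keeps these points distinct. -/
theorem subsingleton_of_subset_punctured {i : ℕ+} {k : ℕ} (hk : k ≤ 2 ^ (i : ℕ)) {D : Set ℕ+}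
    (hD : U₂.IsMSet (k + 1) D) (hsub : D ⊆ punctured i k) : D.Subsingleton := by
  obtain ⟨⟨d, hd⟩, f, δ, hf, rfl⟩ := isMSet_U₂_iff.1 hD
  by_cases hp : ∃ j c, f j = pAttr c ∧ δ j = true
  · obtain ⟨j, c, hc, hj⟩ := hp
    have hsing : ∀ a ∈ {a | ∀ j, f j a = δ j}, a = c := by
      intro a ha
      have := ha j
      rw [hc, hj] at this
      simpa [pAttr] using this
    exact fun a ha b hb => (hsing a ha).trans (hsing b hb).symm
  exfalso
  push Not at hp
  have hout : ∀ s, ∃ j, f j (outerPoint i k s) ≠ δ j := by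
    intro s
    by_contra! h
    exact outerPoint_notMem i k s (hsub h)
  choose φ hφ using hout
  obtain ⟨s, s', hne, heq⟩ := Fintype.exists_ne_map_eq_of_card_lt φ (by simp)
  have h1 := hφ s
  have h2 := hφ s'
  rw [← heq] at h2
  have hds := hd (φ s)
  obtain ⟨hd1, hd2, -⟩ := hsub hd
  have hcs := coe_outerPoint i k s
  have hcs' := coe_outerPoint i k s'
  have hne' : (s : ℕ) ≠ s' := fun h => hne (Fin.ext h)
  rcases hf (φ s) with ⟨c, hc⟩ | ⟨e, he⟩
  · have hδ := hp (φ s) c hc.symm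
    rw [← hc] at h1 h2
    simp only [ne_eq, Bool.not_eq_true] at hδ
    rw [hδ] at h1 h2
    simp only [pAttr, ne_eq, Bool.not_eq_false, decide_eq_true_eq] at h1 h2
    rw [h1] at hcs
    rw [h2] at hcs'
    split_ifs at hcs hcs' <;> omega
  -- The interval contains no power of two in its interior. So an upper threshold met by D can only
  -- exclude the outer point to the right, and a lower one only 2^i.
  · rw [← he] at h1 h2 hds
    cases hδ : δ (φ s) <;> rw [hδ] at h1 h2 hds
    · replace h1 := lAttr_two_pow_eq_true.1 (Bool.eq_true_of_not_eq_false h1)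
      replace h2 := lAttr_two_pow_eq_true.1 (Bool.eq_true_of_not_eq_false h2)
      replace hds := lAttr_two_pow_eq_false.1 hds
      have h3 : (i : ℕ) < e := (Nat.pow_lt_pow_iff_right (a := 2) (by norm_num)).1
        (lt_of_lt_of_le hd1 hds)
      have h4 : 2 ^ ((i : ℕ) + 1) ≤ 2 ^ (e : ℕ) := Nat.pow_le_pow_right (by norm_num) h3
      rw [pow_succ] at h4
      have h1' := lt_of_le_of_lt h4 h1
      have h2' := lt_of_le_of_lt h4 h2
      rw [hcs] at h1'
      rw [hcs'] at h2'
      split_ifs at h1' h2' <;> omega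
    · replace h1 := lAttr_two_pow_eq_false.1 (Bool.eq_false_of_not_eq_true h1)
      replace h2 := lAttr_two_pow_eq_false.1 (Bool.eq_false_of_not_eq_true h2)
      replace hds := lAttr_two_pow_eq_true.1 hds
      have h3 : (e : ℕ) < i + 1 := by
        refine (Nat.pow_lt_pow_iff_right (a := 2) (by norm_num)).1 (lt_of_lt_of_le hds ?_)
        rw [pow_succ]
        omega
      have h4 : 2 ^ (e : ℕ) ≤ 2 ^ (i : ℕ) := Nat.pow_le_pow_right (by norm_num) (by omega)
      have h1' := le_trans h1 h4
      have h2' := le_trans h2 h4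
      rw [hcs] at h1'
      rw [hcs'] at h2'
      split_ifs at h1' h2' <;> omega

theorem not_restrictedCoverage_U₂ : ¬ U₂.RestrictedCoverage := by
  rintro ⟨m, t, hm, -, hcov⟩
  obtain ⟨k, rfl⟩ : ∃ k, m = k + 1 := ⟨m - 1, by omega⟩
  -- The interval is long enough to keep t+1 points after the puncture; each needs a covering set of
  -- its own.
  let i : ℕ+ := (k + t + 1).succPNat
  have hi : k + t + 2 < 2 ^ (i : ℕ) := Nat.lt_two_pow_self
  let pt : Fin (t + 1) → ℕ+ := fun x => (2 ^ (i : ℕ) + k + x).succPNat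
  have hpt : ∀ x, (pt x : ℕ) = 2 ^ (i : ℕ) + k + x + 1 := fun x => Nat.succPNat_coe _
  have hmem : ∀ x, pt x ∈ punctured i k := by
    intro x
    refine ⟨?_, ?_, fun r => ?_⟩ <;> rw [hpt] <;> omega
  obtain ⟨C, hCt, hCm, hC⟩ := hcov (punctured i k) (isMSet_punctured i k ⟨_, hmem 0⟩)
  have hcover : ∀ x, ∃ D : C, pt x ∈ D.1 := by
    intro x
    have := hmem x
    rw [hC] at this
    obtain ⟨D, hD, hx⟩ := this
    exact ⟨⟨D, hD⟩, hx⟩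
  choose D hDx using hcover
  have hinj : Function.Injective D := by
    intro x y hxy
    have hsub : (D x).1 ⊆ punctured i k := by
      rw [hC]
      exact Set.subset_sUnion_of_mem (D x).2
    have := subsingleton_of_subset_punctured (by omega) (hCm _ (D x).2) hsub (hDx x)
      (hxy ▸ hDx y)
    have h := congrArg PNat.val this
    change (pt x : ℕ) = pt y at h
    rw [hpt, hpt] at h
    exact Fin.ext (by omega)
  have hfin : C.Finite := Set.finite_of_encard_le_coe hCt
  have := hfin.fintype
  have h1 := Fintype.card_le_of_injective D hinj
  rw [hfin.encard_eq_coe_toFinset_card] at hCt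
  have h2 : hfin.toFinset.card ≤ t := by exact_mod_cast hCt
  rw [← Set.toFinset_card, Fintype.card_fin] at h1
  have h3 : C.toFinset = hfin.toFinset := by
    ext
    simp
  rw [h3] at h1
  omega

/-! ### The remaining examples -/

theorem coverage_U₄ : U₄.Coverage := by
  classical
  refine ⟨1, le_rfl, fun B hB => ⟨{B}, Set.finite_singleton B, ?_, by simp⟩⟩
  intro D hD
  obtain rfl : D = B := hD
  refine ⟨hB.1, fun _ => ⟨fun a => decide (a ∈ D), trivial⟩, fun _ => true, Set.ext fun a => ?_⟩
  simp

theorem iDim_U₄ : U₄.iDim = ⊤ := by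
  refine iDim_eq_top fun n => ?_
  obtain ⟨e, he⟩ : ∃ e : ℕ+ → Fin n → Bool, Function.Surjective e := by
    obtain ⟨s, hs⟩ := exists_surjective_nat (Fin n → Bool)
    exact ⟨s ∘ PNat.natPred, hs.comp Equiv.pnatEquivNat.surjective⟩
  exact ⟨fun i => ⟨fun a => e a i, trivial⟩, he⟩

theorem iDim_U₅ : U₅.iDim = ⊤ := by
  refine iDim_eq_top fun n => ⟨fun i => ⟨coordAttr (i : ℕ).succPNat, _, rfl⟩, fun x => ?_⟩
  refine ⟨fun k => if h : k.natPred < n then x ⟨k.natPred, h⟩ else false, funext fun i => ?_⟩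
  simp [tuple, coordAttr]

theorem exists_index_notMem {m : ℕ} (g : Fin m → ℕ+) :
    ∃ i : Fin (m + 1), ∀ j, g j ≠ (i : ℕ).succPNat := by
  by_contra! h
  choose φ hφ using h
  have hinj : Function.Injective φ := by
    intro i j hij
    have := (hφ i).symm.trans ((congrArg g hij).trans (hφ j))
    exact Fin.ext (Nat.succPNat_injective this)
  have := Fintype.card_le_of_injective φ hinj
  simp at this

theorem not_coverage_U₅ : ¬ U₅.Coverage := by
  rintro ⟨m, hm, hcov⟩
  let B : Set (ℕ+ → Bool) := {a | ∀ i : Fin (m + 1), coordAttr (i : ℕ).succPNat a = true}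
  have hBne : B.Nonempty := ⟨fun _ => true, fun i => rfl⟩
  obtain ⟨C, -, hC, hBC⟩ := hcov B ⟨hBne, fun i => ⟨coordAttr (i : ℕ).succPNat, _, rfl⟩,
    fun _ => true, rfl⟩
  obtain ⟨b, hb⟩ := hBne
  rw [hBC] at hb
  obtain ⟨D, hD, hbD⟩ := hb
  obtain ⟨-, f, δ, rfl⟩ := hC D hD
  choose g hg using fun j => (f j).2
  -- The m equations of D leave one of the m+1 prescribed coordinates free, and flipping it leaves
  -- B. No cover exists, finite or not.
  obtain ⟨i, hi⟩ := exists_index_notMem g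
  have hmem : Function.update b (i : ℕ).succPNat false ∈ B := by
    rw [hBC]
    refine ⟨_, hD, fun j => ?_⟩
    rw [← hbD j, ← hg]
    exact Function.update_of_ne (hi j) _ _
  have := hmem i
  simp [coordAttr] at this

theorem not_coverage_U₃ : ¬ U₃.Coverage := by
  rintro ⟨m, hm, hcov⟩
  let B : Set ℕ+ := {a | ∀ i : Fin (m + 1), pAttr (i : ℕ).succPNat a = false}
  have hBmem : ∀ a : ℕ+, m + 1 < a → a ∈ B := by
    intro a ha i
    simp only [pAttr, decide_eq_false_iff_not]
    rintro rfl
    simp at ha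
    omega
  have hBinf : B.Infinite := by
    refine (Set.Ioi_infinite m.succPNat).mono fun a ha => hBmem a ?_
    have : (m.succPNat : ℕ) < a := ha
    simpa using this
  obtain ⟨C, hCfin, hC, hBC⟩ := hcov B ⟨hBinf.nonempty,
    fun i => ⟨pAttr (i : ℕ).succPNat, _, rfl⟩, fun _ => false, rfl⟩
  refine hBinf ?_
  rw [hBC]
  refine hCfin.sUnion fun D hD => ?_
  have hDB : D ⊆ B := hBC ▸ Set.subset_sUnion_of_mem hD
  obtain ⟨-, f, δ, rfl⟩ := hC D hD
  choose g hg using fun j => (f j).2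
  -- With an equation p = 1 the piece D is finite. With only equations p = 0 it would contain one of
  -- the m+1 points removed from B. Hence B would be finite.
  by_cases h : ∃ j, δ j = true
  · obtain ⟨j, hj⟩ := h
    refine (Set.finite_singleton (g j)).subset fun a ha => ?_
    have := ha j
    rw [← hg, hj] at this
    simpa [pAttr] using this
  · push Not at h
    obtain ⟨i, hi⟩ := exists_index_notMem g
    have hmem := hDB (a := (i : ℕ).succPNat) fun j => by
      rw [← hg]
      simpa [pAttr, h j] using (hi j).symm
    have := hmem i
    simp [pAttr] at this

theorem theorem1 :
    (∀ U : InfoSystem.{u}, ∃ i : Fin 5,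
      (∀ τ : SystemType, U.HasType τ ↔ τ = typeTable i) ∧
      ((typeTable i).hd = .LOG ↔ U.iDim ≠ ⊤ ∧ U.RestrictedCoverage) ∧
      ((typeTable i).ha = .CON ↔ U.Coverage) ∧
      ((typeTable i).Ld = .POL ↔ U.iDim ≠ ⊤)) ∧
    U₁.HasType (typeTable 0) ∧
    U₂.HasType (typeTable 1) ∧
    U₃.HasType (typeTable 2) ∧
    U₄.HasType (typeTable 3) ∧
    U₅.HasType (typeTable 4) :=
  ⟨exists_row, hasType_zero iDim_U₁_ne_top restrictedCoverage_U₁,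
    hasType_one iDim_U₂_ne_top coverage_U₂ not_restrictedCoverage_U₂,
    hasType_two iDim_U₃_ne_top not_coverage_U₃, hasType_three iDim_U₄ coverage_U₄,
    hasType_four iDim_U₅ not_coverage_U₅⟩
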